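/- Let $k$ be an algebraically closed field of characteristic $0$ and let $R \subseteq k[[x]]$ be a complete (local) $k$-subalgebra such that $k[[x]]$ is a finite $R$-module and $R$ and $k[[x]]$ have the same fraction field $k((x))$ (so $k[[x]]$ is the normalization of $R$). Let $\mathfrak m$ be the maximal ideal of $R$ and $X = \mathrm{Spec}\, R$. Put $$S := \{\, i \in \mathbb{N}_0 \mid \exists f \in R,\ \mathrm{ord}\, f = i \,\} = \{0 = s_{-1} < s_0 < s_1 < \cdots\}.$$ For $n \in \mathbb{N}_0$ let $\hat P^n_R := (R \hat\otimes_k R)/\hat I^{\,n+1}$ be the complete module of principal parts, where $R \hat\otimes_k R$ is the completion of $R \otimes_k R$ with respect to the ideal $\mathfrak m \otimes R + R \otimes \mathfrak m$ and $\hat I$ is the ideal generated by the elements $a \otimes 1 - 1 \otimes a$, $a \in R$; regard it as an $R$-module via $a \mapsto a \otimes 1$. It is locally free of rank $n+1$ on a dense open subset $U$ of $X$. The $n$-th Nash blowup $\mathbf{Nash}_n(X)$ is the closure, with reduced scheme structure, of $\mathbf{Grass}_{n+1}(\hat P^n_R) \times_X U$ in the Grassmannian $\mathbf{Grass}_{n+1}(\hat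 P^n_R)$ of locally free quotients of rank $n+1$ of $\hat P^n_R$ over $X$. Then, for every $n \in \mathbb{N}_0$, the scheme $\mathbf{Nash}_n(X)$ is regular (all its local rings are regular) if and only if $s_n - 1 \in S$. -/

import Mathlib

open CategoryTheory CategoryTheory.Limits AlgebraicGeometry TopologicalSpace
open scoped TensorProduct PowerSeries LaurentSeries

universe u

noncomputable section

namespace NashBlowup

/-! ## The Grassmannian of rank `r` quotients of a module, glued from its standard charts -/

section Grassmannian

variable {R : Type u} [CommRing R] {M : Type u} [AddCommGroup M] [Module R M] {r : ℕ}

/-- The relations `φ(b j)_i = δ_{ij}` in the symmetric algebra of `M^r`; the element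
`ι (Pi.single i m)` stands for the `i`-th coordinate `φ(m)_i` of the image of `m` under a
linear map `φ` to a free module of rank `r`. -/
def chartIdeal (b : Fin r → M) : Ideal (SymmetricAlgebra R (Fin r → M)) :=
  Ideal.span (Set.range fun p : Fin r × Fin r =>
    SymmetricAlgebra.ι R (Fin r → M) (Pi.single p.1 (b p.2)) - if p.1 = p.2 then 1 else 0)

/-- The coordinate ring of the standard chart of the Grassmannian belonging to an `r`-tuple `b` of
elements of `M`.  For an `R`-algebra `A`, the `R`-algebra maps from it to `A` are the `R`-linear maps
`φ : M → A^r` that send `b` to the standard basis, that is, the quotients of `A ⊗ M` that are free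
with basis the image of `b`. -/
abbrev ChartRing (R : Type u) [CommRing R] {M : Type u} [AddCommGroup M] [Module R M] {r : ℕ}
    (b : Fin r → M) : Type u :=
  SymmetricAlgebra R (Fin r → M) ⧸ chartIdeal (R := R) b

/-- The universal linear map `M → A^r` over the chart of `b` (`A` the chart's coordinate ring). -/
def coord (b : Fin r → M) : M →ₗ[R] (Fin r → ChartRing R b) :=
  LinearMap.pi fun i => (Ideal.Quotient.mkₐ R (chartIdeal (R := R) b)).toLinearMap ∘ₗ
    SymmetricAlgebra.ι R (Fin r → M) ∘ₗ LinearMap.single R (fun _ => M) i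

theorem coord_self (b : Fin r → M) (j : Fin r) : coord (R := R) b (b j) = Pi.single j 1 := by
  ext i
  have h : (Ideal.Quotient.mk (chartIdeal (R := R) b))
      (SymmetricAlgebra.ι R (Fin r → M) (Pi.single i (b j)) - if i = j then 1 else 0) = 0 :=
    Ideal.Quotient.eq_zero_iff_mem.2 (Ideal.subset_span ⟨(i, j), rfl⟩)
  rw [map_sub, sub_eq_zero] at h
  change (Ideal.Quotient.mk (chartIdeal (R := R) b))
      (SymmetricAlgebra.ι R (Fin r → M) (Pi.single i (b j))) = _
  rw [h]
  by_cases hij : i = j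
  · subst hij; simp
  · simp [hij]

/-- The universal property of the chart. -/
def chartLift (b : Fin r → M) {A : Type u} [CommRing A] [Algebra R A] (φ : M →ₗ[R] (Fin r → A))
    (h : ∀ j, φ (b j) = Pi.single j 1) : ChartRing R b →ₐ[R] A :=
  Ideal.Quotient.liftₐ (chartIdeal (R := R) b)
    (SymmetricAlgebra.lift (∑ i, LinearMap.proj i ∘ₗ φ ∘ₗ LinearMap.proj i)) (by
      intro a ha
      have : chartIdeal (R := R) b ≤ RingHom.ker
          (SymmetricAlgebra.lift (R := R)
            (∑ i, LinearMap.proj i ∘ₗ φ ∘ₗ LinearMap.proj i : (Fin r → M) →ₗ[R] A)) := by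
        rw [chartIdeal, Ideal.span_le]
        rintro _ ⟨⟨i, j⟩, rfl⟩
        simp only [SetLike.mem_coe, RingHom.mem_ker, map_sub, SymmetricAlgebra.lift_ι_apply]
        rw [LinearMap.sum_apply, Finset.sum_eq_single i]
        · by_cases hij : i = j
          · subst hij; simp [h]
          · simp [h, hij]
        · intro k _ hk
          simp [Pi.single_eq_of_ne hk]
        · simp
      exact this ha)

theorem chartLift_coord (b : Fin r → M) {A : Type u} [CommRing A] [Algebra R A]
    (φ : M →ₗ[R] (Fin r → A)) (h : ∀ j, φ (b j) = Pi.single j 1) (m : M) (i : Fin r) :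
    chartLift b φ h (coord b m i) = φ m i := by
  change SymmetricAlgebra.lift (R := R)
    (∑ i, LinearMap.proj i ∘ₗ φ ∘ₗ LinearMap.proj i : (Fin r → M) →ₗ[R] A)
      (SymmetricAlgebra.ι R (Fin r → M) (Pi.single i m)) = _
  rw [SymmetricAlgebra.lift_ι_apply, LinearMap.sum_apply, Finset.sum_eq_single i]
  · simp
  · intro k _ hk
    simp [Pi.single_eq_of_ne hk]
  · simp

/-- Ring homomorphisms from a chart are determined by their restriction to `R` and the images of
the coordinates. -/
theorem chart_hom_ext {b : Fin r → M} {B : Type u} [CommRing B] {f g : ChartRing R b →+* B}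
    (hR : ∀ a : R, f (algebraMap R _ a) = g (algebraMap R _ a))
    (hM : ∀ m i, f (coord b m i) = g (coord b m i)) : f = g := by
  let _ : Algebra R B := (f.comp (algebraMap R (ChartRing R b))).toAlgebra
  let f' : ChartRing R b →ₐ[R] B := { f with commutes' := fun _ => rfl }
  let g' : ChartRing R b →ₐ[R] B := { g with commutes' := fun a => (hR a).symm }
  have : f' = g' := by
    refine Ideal.Quotient.algHom_ext R ?_
    refine SymmetricAlgebra.algHom_ext ?_
    refine LinearMap.pi_ext fun i m => ?_
    exact hM m i
  ext x
  exact congr($this x)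

/-- The matrix of the coordinates of the tuple `b'` over the chart of `b`. -/
def transMatrix (R : Type u) [CommRing R] {M : Type u} [AddCommGroup M] [Module R M] {r : ℕ}
    (b b' : Fin r → M) : Matrix (Fin r) (Fin r) (ChartRing R b) :=
  Matrix.of fun i j => coord b (b' j) i

/-- On the chart of `b`, the locus where `b'` is a basis as well is where this is invertible. -/
abbrev transDet (R : Type u) [CommRing R] {M : Type u} [AddCommGroup M] [Module R M] {r : ℕ}
    (b b' : Fin r → M) : ChartRing R b :=
  (transMatrix R b b').det

/-- The coordinate ring of the overlap of the charts of `b` and `b'`, as an open part of the chart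
of `b`. -/
abbrev OverlapRing (R : Type u) [CommRing R] {M : Type u} [AddCommGroup M] [Module R M] {r : ℕ}
    (b b' : Fin r → M) : Type u :=
  Localization.Away (transDet R b b')

theorem isUnit_det_map {b b' : Fin r → M} {B : Type u} [CommRing B] (h : ChartRing R b →+* B)
    (hu : IsUnit (h (transDet R b b'))) : IsUnit (h.mapMatrix (transMatrix R b b')).det := by
  rwa [← RingHom.map_det]

theorem mulVec_self (b b' : Fin r → M) {B : Type u} [CommRing B] (h : ChartRing R b →+* B)
    (hu : IsUnit (h (transDet R b b'))) (j : Fin r) :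
    (h.mapMatrix (transMatrix R b b'))⁻¹.mulVec (fun i => h (coord b (b' j) i)) =
      Pi.single j 1 := by
  have h1 : (fun i => h (coord b (b' j) i)) =
      (h.mapMatrix (transMatrix R b b')).mulVec (Pi.single j 1) := by
    ext i; simp [transMatrix]
  rw [h1, Matrix.mulVec_mulVec, Matrix.nonsing_inv_mul _ (isUnit_det_map h hu), Matrix.one_mulVec]

theorem isUnit_overlap (b b' : Fin r → M) :
    IsUnit (algebraMap (ChartRing R b) (OverlapRing R b b') (transDet R b b')) :=
  IsLocalization.Away.algebraMap_isUnit _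

/-- The change of coordinates: on the overlap, the coordinates with respect to `b'` are obtained
from those with respect to `b` by multiplication with the inverse of the matrix `transMatrix`. -/
def transition (R : Type u) [CommRing R] {M : Type u} [AddCommGroup M] [Module R M] {r : ℕ}
    (b b' : Fin r → M) : ChartRing R b' →ₐ[R] OverlapRing R b b' :=
  chartLift b'
    { toFun := fun m =>
        ((algebraMap (ChartRing R b) (OverlapRing R b b')).mapMatrix (transMatrix R b b'))⁻¹.mulVec
          (fun i => algebraMap _ _ (coord b m i))
      map_add' := fun m m' => by
        rw [← Matrix.mulVec_add]; congr 1; ext i; simp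
      map_smul' := fun a m => by
        rw [RingHom.id_apply, ← Matrix.mulVec_smul]; congr 1; ext i
        rw [map_smul, Pi.smul_apply, Pi.smul_apply, ← Algebra.linearMap_apply,
          ← Algebra.linearMap_apply]
        exact ((Algebra.linearMap (ChartRing R b) (OverlapRing R b b')).restrictScalars R).map_smul
          a (coord b m i) }
    (fun j => mulVec_self b b' (algebraMap (ChartRing R b) (OverlapRing R b b'))
      (isUnit_overlap b b') j)

theorem transition_coord (b b' : Fin r → M) (m : M) {B : Type u} [CommRing B]
    (u : OverlapRing R b b' →+* B) :
    (fun i => u (transition R b b' (coord (R := R) b' m i))) =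
      ((u.comp (algebraMap (ChartRing R b) _)).mapMatrix (transMatrix R b b'))⁻¹.mulVec
          (fun i => u (algebraMap (ChartRing R b) (OverlapRing R b b') (coord b m i))) := by
  ext i
  rw [transition, chartLift_coord]
  set N := (algebraMap (ChartRing R b) (OverlapRing R b b')).mapMatrix (transMatrix R b b') with hN
  have hdet : IsUnit N.det := isUnit_det_map _ (isUnit_overlap b b')
  have h1 : (u.comp (algebraMap (ChartRing R b) _)).mapMatrix (transMatrix R b b') =
      u.mapMatrix N := by
    rw [hN]; rfl
  have h2 : (u.mapMatrix N)⁻¹ = u.mapMatrix N⁻¹ := by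
    refine Matrix.inv_eq_left_inv ?_
    rw [← map_mul, Matrix.nonsing_inv_mul _ hdet, map_one]
  rw [h1, h2]
  change u (N⁻¹.mulVec _ i) = _
  simp [Matrix.mulVec, dotProduct, map_sum]

/-- The matrix of `b''` with respect to `b'` on the overlap of the charts of `b` and `b'`. -/
theorem transition_matrix (b b' b'' : Fin r → M) {B : Type u} [CommRing B]
    (u : OverlapRing R b b' →+* B) :
    (u.comp (transition R b b').toRingHom).mapMatrix (transMatrix R b' b'') =
      ((u.comp (algebraMap (ChartRing R b) _)).mapMatrix (transMatrix R b b'))⁻¹ *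
        (u.comp (algebraMap (ChartRing R b) _)).mapMatrix (transMatrix R b b'') := by
  ext i j
  have := congrFun (transition_coord b b' (b'' j) u) i
  simpa [transMatrix, Matrix.mul_apply, Matrix.mulVec, dotProduct] using this

/-- On the triple overlap of the charts of `b`, `b'`, `b''` the changes of coordinates are
compatible. -/
theorem triple_overlap (b b' b'' : Fin r → M) {B : Type u} [CommRing B]
    (u : OverlapRing R b b' →+* B) (v : OverlapRing R b b'' →+* B)
    (huv : u.comp (algebraMap (ChartRing R b) _) = v.comp (algebraMap (ChartRing R b) _)) :
    ∃ w : OverlapRing R b' b'' →+* B,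
      w.comp (algebraMap (ChartRing R b') _) = u.comp (transition R b b').toRingHom ∧
      w.comp (transition R b' b'').toRingHom = v.comp (transition R b b'').toRingHom := by
  set h := u.comp (algebraMap (ChartRing R b) _) with hh
  have hu' : IsUnit (h (transDet R b b')) := (isUnit_overlap b b').map u
  have hv' : IsUnit (h (transDet R b b'')) := by rw [huv]; exact (isUnit_overlap b b'').map v
  set X := h.mapMatrix (transMatrix R b b') with hX
  set Y := h.mapMatrix (transMatrix R b b'') with hY
  have hXu : IsUnit X.det := isUnit_det_map h hu'
  have hYu : IsUnit Y.det := isUnit_det_map h hv'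
  set g := u.comp (transition R b b').toRingHom with hg
  have hmat : g.mapMatrix (transMatrix R b' b'') = X⁻¹ * Y := transition_matrix b b' b'' u
  have hgu : IsUnit (g (transDet R b' b'')) := by
    rw [RingHom.map_det, hmat, Matrix.det_mul]
    exact (Matrix.isUnit_nonsing_inv_det _ hXu).mul hYu
  refine ⟨IsLocalization.Away.lift (S := OverlapRing R b' b'') (transDet R b' b'') hgu,
    IsLocalization.Away.lift_comp _ _, ?_⟩
  set w := IsLocalization.Away.lift (S := OverlapRing R b' b'') (transDet R b' b'') hgu with hw
  have hwg : w.comp (algebraMap (ChartRing R b') _) = g := IsLocalization.Away.lift_comp _ _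
  refine chart_hom_ext (fun a => ?_) (fun m i => ?_)
  · have e1 : w (algebraMap R _ a) = g (algebraMap R _ a) := by
      rw [← hwg, RingHom.comp_apply, ← IsScalarTower.algebraMap_apply]
    have e2 : u (algebraMap R _ a) = v (algebraMap R _ a) := by
      have := congr($huv (algebraMap R _ a))
      simpa only [hh, RingHom.comp_apply, ← IsScalarTower.algebraMap_apply] using this
    change w (transition R b' b'' (algebraMap R _ a)) = v (transition R b b'' (algebraMap R _ a))
    rw [AlgHom.commutes, AlgHom.commutes, e1, ← e2]
    change u (transition R b b' (algebraMap R _ a)) = _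
    rw [AlgHom.commutes]
  · have e1 := transition_coord b' b'' m w
    have e2 := transition_coord b b'' m v
    have e3 := transition_coord b b' m u
    have e4 : (fun i => w (algebraMap (ChartRing R b') (OverlapRing R b' b'') (coord b' m i))) =
        X⁻¹.mulVec (fun i => h (coord b m i)) := by
      refine Eq.trans ?_ e3
      ext i; exact congr($hwg (coord b' m i))
    rw [hwg, hmat, e4, Matrix.mulVec_mulVec, Matrix.mul_inv_rev, Matrix.mul_assoc,
      Matrix.nonsing_inv_nonsing_inv _ hXu, Matrix.mul_nonsing_inv _ hXu, Matrix.mul_one] at e1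
    have e5 : (fun i => v (algebraMap (ChartRing R b) (OverlapRing R b b'') (coord b m i))) =
        fun i => h (coord b m i) := by
      ext i; exact congr($huv.symm (coord b m i))
    rw [← huv, e5] at e2
    exact congrFun (e1.trans e2.symm) i

theorem transMatrix_self (b : Fin r → M) : transMatrix R b b = 1 := by
  ext i j
  simp [transMatrix, coord_self, Matrix.one_apply, Pi.single_apply]

theorem transDet_self (b : Fin r → M) : transDet R b b = 1 := by
  rw [transDet, transMatrix_self, Matrix.det_one]

theorem isUnit_transition (b b' : Fin r → M) :
    IsUnit ((transition R b b').toRingHom (transDet R b' b)) := by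
  have := transition_matrix (R := R) b b' b (RingHom.id _)
  rw [RingHom.id_comp, transMatrix_self, map_one, mul_one] at this
  rw [RingHom.map_det, this]
  exact Matrix.isUnit_nonsing_inv_det _ (isUnit_det_map _ (isUnit_overlap b b'))

/-- The identification of the two descriptions of the overlap of the charts of `b` and `b'`. -/
def overlapSwap (R : Type u) [CommRing R] {M : Type u} [AddCommGroup M] [Module R M] {r : ℕ}
    (b b' : Fin r → M) : OverlapRing R b' b →+* OverlapRing R b b' :=
  IsLocalization.Away.lift (S := OverlapRing R b' b) (transDet R b' b) (isUnit_transition b b')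

theorem overlapSwap_comp (b b' : Fin r → M) :
    (overlapSwap R b b').comp (algebraMap (ChartRing R b') _) =
      (transition R b b').toRingHom :=
  IsLocalization.Away.lift_comp _ _

theorem overlapSwap_transition (b b' : Fin r → M) :
    (overlapSwap R b b').comp (transition R b' b).toRingHom =
      algebraMap (ChartRing R b) (OverlapRing R b b') := by
  set s := overlapSwap R b b' with hs
  have hsc : s.comp (algebraMap (ChartRing R b') _) = (transition R b b').toRingHom :=
    overlapSwap_comp b b'
  refine chart_hom_ext (fun a => ?_) (fun m i => ?_)
  · change s (transition R b' b (algebraMap R _ a)) = _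
    rw [AlgHom.commutes, ← IsScalarTower.algebraMap_apply,
      IsScalarTower.algebraMap_apply R (ChartRing R b') (OverlapRing R b' b)]
    have := congr($hsc (algebraMap R _ a))
    refine this.trans ?_
    exact (transition R b b').commutes a
  · have e1 := transition_coord b' b m s
    have e2 := transition_coord b b' m (RingHom.id (OverlapRing R b b'))
    have e3 := transition_matrix (R := R) b b' b (RingHom.id _)
    rw [RingHom.id_comp, transMatrix_self, map_one, mul_one, RingHom.id_comp] at e3
    have e4 : (fun i => s (algebraMap (ChartRing R b') (OverlapRing R b' b) (coord b' m i))) =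
        fun i => transition R b b' (coord b' m i) := by
      ext i; exact congr($hsc (coord b' m i))
    have hX := isUnit_det_map (algebraMap (ChartRing R b) (OverlapRing R b b'))
      (isUnit_overlap b b')
    rw [RingHom.id_comp] at e2
    simp only [RingHom.id_apply] at e2
    rw [hsc, e3, e4, e2, Matrix.mulVec_mulVec, Matrix.nonsing_inv_nonsing_inv _ hX,
      Matrix.mul_nonsing_inv _ hX, Matrix.one_mulVec] at e1
    exact congrFun e1 i

theorem transition_self (b : Fin r → M) :
    (transition R b b).toRingHom = algebraMap (ChartRing R b) (OverlapRing R b b) := by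
  refine chart_hom_ext (fun a => ?_) (fun m i => ?_)
  · rw [← IsScalarTower.algebraMap_apply]
    exact (transition R b b).commutes a
  · have e := transition_coord b b m (RingHom.id (OverlapRing R b b))
    rw [transMatrix_self, map_one, inv_one, Matrix.one_mulVec] at e
    exact congrFun e i

theorem overlapSwap_self (b : Fin r → M) : overlapSwap R b b = RingHom.id _ := by
  refine IsLocalization.ringHom_ext (Submonoid.powers (transDet R b b)) ?_
  rw [overlapSwap_comp, transition_self, RingHom.id_comp]

/-- The chart of `b`. -/
abbrev chart (R : Type u) [CommRing R] {M : Type u} [AddCommGroup M] [Module R M] {r : ℕ}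
    (b : Fin r → M) : Scheme.{u} := Spec (CommRingCat.of (ChartRing R b))

/-- The overlap of two charts. -/
abbrev overlap (R : Type u) [CommRing R] {M : Type u} [AddCommGroup M] [Module R M] {r : ℕ}
    (b b' : Fin r → M) : Scheme.{u} := Spec (CommRingCat.of (OverlapRing R b b'))

/-- The inclusion of the overlap in the first chart. -/
abbrev overlapFst (R : Type u) [CommRing R] {M : Type u} [AddCommGroup M] [Module R M] {r : ℕ}
    (b b' : Fin r → M) : overlap R b b' ⟶ chart R b :=
  Spec.map (CommRingCat.ofHom (algebraMap (ChartRing R b) (OverlapRing R b b')))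

/-- The inclusion of the overlap in the second chart. -/
abbrev overlapSnd (R : Type u) [CommRing R] {M : Type u} [AddCommGroup M] [Module R M] {r : ℕ}
    (b b' : Fin r → M) : overlap R b b' ⟶ chart R b' :=
  Spec.map (CommRingCat.ofHom (transition R b b').toRingHom)

/-- The identification of the two overlaps. -/
abbrev overlapFlip (R : Type u) [CommRing R] {M : Type u} [AddCommGroup M] [Module R M] {r : ℕ}
    (b b' : Fin r → M) : overlap R b b' ⟶ overlap R b' b :=
  Spec.map (CommRingCat.ofHom (overlapSwap R b b'))

theorem overlapFlip_fst (b b' : Fin r → M) :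
    overlapFlip R b b' ≫ overlapFst R b' b = overlapSnd R b b' := by
  rw [← Spec.map_comp, ← CommRingCat.ofHom_comp, overlapSwap_comp]

theorem overlapFlip_snd (b b' : Fin r → M) :
    overlapFlip R b b' ≫ overlapSnd R b' b = overlapFst R b b' := by
  rw [← Spec.map_comp, ← CommRingCat.ofHom_comp, overlapSwap_transition]

theorem exists_eq_toSpecΓ {W : Scheme.{u}} {A : CommRingCat.{u}} (f : W ⟶ Spec A) :
    ∃ φ : A ⟶ Γ(W, ⊤), f = W.toSpecΓ ≫ Spec.map φ := by
  refine ⟨(Scheme.ΓSpecIso A).inv ≫ f.appTop, ?_⟩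
  rw [Spec.map_comp, ← Scheme.toSpecΓ_naturality_assoc, toSpecΓ_SpecMap_ΓSpecIso_inv,
    Category.comp_id]

theorem toSpecΓ_injective {W : Scheme.{u}} {A : CommRingCat.{u}} {φ ψ : A ⟶ Γ(W, ⊤)}
    (h : W.toSpecΓ ≫ Spec.map φ = W.toSpecΓ ≫ Spec.map ψ) : φ = ψ := by
  have := congrArg Scheme.Hom.appTop h
  rw [Scheme.Hom.comp_appTop, Scheme.Hom.comp_appTop, Scheme.toSpecΓ_appTop,
    Scheme.ΓSpecIso_naturality, Scheme.ΓSpecIso_naturality] at this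
  exact (Iso.cancel_iso_hom_left _ _ _).1 this

theorem exists_triple {W : Scheme.{u}} (b b' b'' : Fin r → M) (p : W ⟶ overlap R b b')
    (q : W ⟶ overlap R b b'') (h : p ≫ overlapFst R b b' = q ≫ overlapFst R b b'') :
    ∃ s : W ⟶ overlap R b' b'', s ≫ overlapFst R b' b'' = p ≫ overlapSnd R b b' ∧
      s ≫ overlapSnd R b' b'' = q ≫ overlapSnd R b b'' := by
  obtain ⟨φ, rfl⟩ := exists_eq_toSpecΓ p
  obtain ⟨ψ, rfl⟩ := exists_eq_toSpecΓ q
  simp only [Category.assoc, ← Spec.map_comp] at h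
  have h' := toSpecΓ_injective h
  obtain ⟨w, hw1, hw2⟩ := triple_overlap (R := R) b b' b'' φ.hom ψ.hom
    (by simpa using congrArg CommRingCat.Hom.hom h')
  refine ⟨W.toSpecΓ ≫ Spec.map (CommRingCat.ofHom w), ?_, ?_⟩
  · simp only [Category.assoc, ← Spec.map_comp]
    congr 2
    ext1
    simpa using hw1
  · simp only [Category.assoc, ← Spec.map_comp]
    congr 2
    ext1
    simpa using hw2

theorem overlapFst_isIso (b : Fin r → M) : IsIso (overlapFst R b b) := by
  have : Function.Bijective (algebraMap (ChartRing R b) (OverlapRing R b b)) :=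
    (IsLocalization.atUnit (ChartRing R b) (OverlapRing R b b) (transDet R b b)
      (by rw [transDet_self]; exact isUnit_one)).bijective
  have : IsIso (CommRingCat.ofHom (algebraMap (ChartRing R b) (OverlapRing R b b))) :=
    (ConcreteCategory.isIso_iff_bijective _).2 this
  infer_instance

/-- The morphism from the triple overlap, seen in the chart of `b`, to the triple overlap, seen in
the chart of `b'`. -/
def tripleMap (R : Type u) [CommRing R] {M : Type u} [AddCommGroup M] [Module R M] {r : ℕ}
    (b b' b'' : Fin r → M) :
    pullback (overlapFst R b b') (overlapFst R b b'') ⟶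
      pullback (overlapFst R b' b'') (overlapFst R b' b) :=
  pullback.lift (exists_triple b b' b'' _ _ pullback.condition).choose
    (pullback.fst _ _ ≫ overlapFlip R b b') (by
      rw [(exists_triple b b' b'' _ _ pullback.condition).choose_spec.1, Category.assoc,
        overlapFlip_fst])

theorem tripleMap_fst_fst (b b' b'' : Fin r → M) :
    tripleMap R b b' b'' ≫ pullback.fst _ _ ≫ overlapFst R b' b'' =
      pullback.fst _ _ ≫ overlapSnd R b b' := by
  rw [tripleMap, pullback.lift_fst_assoc]
  exact (exists_triple b b' b'' _ _ pullback.condition).choose_spec.1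

theorem tripleMap_fst_snd (b b' b'' : Fin r → M) :
    tripleMap R b b' b'' ≫ pullback.fst _ _ ≫ overlapSnd R b' b'' =
      pullback.snd _ _ ≫ overlapSnd R b b'' := by
  rw [tripleMap, pullback.lift_fst_assoc]
  exact (exists_triple b b' b'' _ _ pullback.condition).choose_spec.2

theorem tripleMap_snd (b b' b'' : Fin r → M) :
    tripleMap R b b' b'' ≫ pullback.snd _ _ = pullback.fst _ _ ≫ overlapFlip R b b' := by
  rw [tripleMap, pullback.lift_snd]

theorem tripleMap_cocycle (b b' b'' : Fin r → M) :
    tripleMap R b b' b'' ≫ tripleMap R b' b'' b ≫ tripleMap R b'' b b' = 𝟙 _ := by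
  have key : (tripleMap R b b' b'' ≫ tripleMap R b' b'' b ≫ tripleMap R b'' b b') ≫
      pullback.fst _ _ = pullback.fst _ _ := by
    rw [← cancel_mono (overlapFst R b b')]
    simp only [Category.assoc]
    rw [tripleMap_fst_fst b'' b b', tripleMap_fst_snd b' b'' b, ← Category.assoc,
      tripleMap_snd, Category.assoc, overlapFlip_snd]
  refine pullback.hom_ext (by rw [key, Category.id_comp]) ?_
  rw [← cancel_mono (overlapFst R b b''), Category.id_comp, Category.assoc, ← pullback.condition,
    ← Category.assoc, key]

variable (R M r) in
/-- The gluing datum of the standard charts of the Grassmannian, indexed by all `r`-tuples of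
elements of `M`. -/
def grassmannianGlueData : Scheme.GlueData.{u} where
  J := Fin r → M
  U b := chart R b
  V p := overlap R p.1 p.2
  f b b' := overlapFst R b b'
  f_id b := overlapFst_isIso b
  t b b' := overlapFlip R b b'
  t_id b := by
    rw [overlapFlip, overlapSwap_self]
    exact Spec.map_id _
  t' b b' b'' := tripleMap R b b' b''
  t_fac b b' b'' := tripleMap_snd b b' b''
  cocycle b b' b'' := tripleMap_cocycle b b' b''
  f_open _ _ := inferInstance

variable (R M r) in
/-- The Grassmannian `Grass_r(M)` over `Spec R` of locally free rank `r` quotients of the sheaf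
associated to the `R`-module `M`, as the scheme glued from its standard charts. -/
def grassmannian : Scheme.{u} := (grassmannianGlueData R M r).glued

theorem chart_structure_compat (b b' : Fin r → M) :
    overlapFst R b b' ≫ Spec.map (CommRingCat.ofHom (algebraMap R (ChartRing R b))) =
      (overlapFlip R b b' ≫ overlapFst R b' b) ≫
        Spec.map (CommRingCat.ofHom (algebraMap R (ChartRing R b'))) := by
  rw [overlapFlip_fst, ← Spec.map_comp, ← Spec.map_comp, ← CommRingCat.ofHom_comp,
    ← CommRingCat.ofHom_comp]
  congr 2
  ext a
  exact ((transition R b b').commutes a).symm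

variable (R M r) in
/-- The structure morphism of the Grassmannian. -/
def grassmannianπ : grassmannian R M r ⟶ Spec (CommRingCat.of R) :=
  Multicoequalizer.desc _ _
    (fun b => Spec.map (CommRingCat.ofHom (algebraMap R (ChartRing R (b : Fin r → M)))))
    (fun p => chart_structure_compat p.1 p.2)

end Grassmannian

/-! ## Nash blowups -/

section Nash

variable (R : Type u) [CommRing R] (M : Type u) [AddCommGroup M] [Module R M] (r : ℕ)

/-- The locus `U ⊆ Spec R` on which the sheaf associated to `M` is locally free of rank `r` (an open
set for finitely presented `M`). -/
def freeRankLocus : Set (PrimeSpectrum R) :=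
  {p | p ∈ Module.freeLocus R M ∧ Module.rankAtStalk M p = r}

/-- The underlying closed set of the Nash blowup: the closure of `Grass_r(M) ×_{Spec R} U` in
`Grass_r(M)`. -/
def nashSet : Closeds (grassmannian R M r) :=
  Closeds.closure ((grassmannianπ R M r) ⁻¹' freeRankLocus R M r)

/-- The Nash blowup `Nash(Spec R, M)` associated to an `R`-module `M` that is locally free of rank
`r` on a dense open subset `U` of `Spec R`: the closure of `Grass_r(M) ×_{Spec R} U` in `Grass_r(M)`,
with its reduced scheme structure. -/
def nash : Scheme.{u} :=
  (Scheme.IdealSheafData.vanishingIdeal (nashSet R M r)).subscheme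

end Nash

/-- A scheme is regular if all its local rings are regular local rings. -/
def IsRegularScheme (X : Scheme.{u}) : Prop :=
  ∀ x : X, IsRegularLocalRing (X.presheaf.stalk x)

/-! ## The complete module of principal parts -/

section PrincipalParts

variable (k : Type u) {A : Type u} [CommRing k] [CommRing A] [Algebra k A] (m : Ideal A)

/-- The ideal `m ⊗ A + A ⊗ m` of `A ⊗ A`. -/
def tensorIdeal : Ideal (A ⊗[k] A) :=
  m.map (Algebra.TensorProduct.includeLeft : A →ₐ[k] A ⊗[k] A) ⊔
    m.map (Algebra.TensorProduct.includeRight : A →ₐ[k] A ⊗[k] A)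

/-- The complete tensor product of a complete local `k`-algebra `(A, m)` with itself.  It is an
`A`-algebra via `a ↦ a ⊗ 1`. -/
abbrev CompletedTensor : Type u := AdicCompletion (tensorIdeal k m) (A ⊗[k] A)

/-- The ideal of the diagonal in the complete tensor product: it is generated by the elements
`a ⊗ 1 - 1 ⊗ a` (equivalently by those for `a` in a system of generators of `m`, when `A` is a
complete local Noetherian ring with coefficient field `k`). -/
def diagonalIdeal : Ideal (CompletedTensor k m) :=
  Ideal.span (Set.range fun a : A => algebraMap (A ⊗[k] A) (CompletedTensor k m)
    (a ⊗ₜ[k] 1 - 1 ⊗ₜ[k] a))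

/-- The complete module of principal parts of order `n`, an `A`-module via `a ↦ a ⊗ 1`. -/
abbrev PrincipalParts (n : ℕ) : Type u := CompletedTensor k m ⧸ diagonalIdeal k m ^ (n + 1)

/-- The `n`-th Nash blowup of `Spec A` for a complete local `k`-algebra `(A, m)` of dimension `d`:
the Nash blowup associated to the complete module of principal parts of order `n`, whose generic rank
is the binomial coefficient of `n + d` over `d`. -/
def higherNash (d n : ℕ) : Scheme.{u} := nash A (PrincipalParts k m n) ((n + d).choose d)

end PrincipalParts

/-! ## Subalgebras of `k[[x]]` -/

section Curve

variable {k : Type u} [Field k] (R : Subalgebra k k⟦X⟧)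

/-- The elements of `R` without constant term; this is the maximal ideal of `R` when `k[[x]]` is
integral over `R`. -/
def maxIdeal : Ideal R :=
  (IsLocalRing.maximalIdeal k⟦X⟧).comap (algebraMap R k⟦X⟧)

/-- The monoid `S` of the orders of the nonzero elements of `R`. -/
def orderMonoid : AddSubmonoid ℕ where
  carrier := {i | ∃ f ∈ R, PowerSeries.order f = i}
  zero_mem' := ⟨1, R.one_mem, by simp⟩
  add_mem' := by
    rintro i j ⟨f, hf, hfi⟩ ⟨g, hg, hgj⟩
    exact ⟨f * g, R.mul_mem hf hg, by rw [PowerSeries.order_mul, hfi, hgj]; simp⟩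

/-- The element `s_n` of `S = {0 = s_{-1} < s_0 < s_1 < ⋯}`. -/
def orderSeq (n : ℕ) : ℕ := Nat.nth (· ∈ orderMonoid R) (n + 1)

end Curve

end NashBlowup

end

/-!
Write `K = k⸨x⸩`, let `c` be a conductor exponent, so that `x ^ c k⟦x⟧ ⊆ R`, and let
`σ 0 < σ 1 < ⋯` be the orders of the elements of `R`, so that `s_n = σ (n + 1)`.

*Charts.*  Let `M` be a module over a domain `R` with fraction field `K`, and `Φ : M → K ^ r` an
`R`-linear map with torsion kernel whose image spans.  The Nash blowup of `M` is the closure of one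
point of the Grassmannian, the generic one, given by `Φ`.  Hence its intersection with the chart of
an `r`-tuple `b` is empty unless `Φ ∘ b` is a basis of `K ^ r`, and then it is the spectrum of the
subring of `K` generated over `R` by the coordinates of the vectors `Φ m` in this basis
(`isRegularScheme_nash_iff`).

*Principal parts.*  The completion of `R ⊗ R` maps to `k⟦x⟧⟦y⟧` by `f ⊗ g ↦ f(x) g(y)`, and the
diagonal ideal goes to the multiples of `y - x`.  In characteristic zero, a power series is divisible
by `(y - x) ^ (n + 1)` if and only if the iterates `(y ∂/∂y) ^ j`, `j ≤ n`, of it vanish on the diagonal.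
So `f ⊗ g ↦ (f · (x d/dx) ^ j g)_j` defines a map `Φ` on the module of principal parts
(`principalJet`).  Its kernel is torsion: multiplication by `x ^ c y ^ c` maps `k⟦x⟧⟦y⟧` back to the
completion (`Conductor.transfer`), and up to a power of `x` the element `y - x` comes from the
diagonal ideal.

*The adapted chart.*  Choose `g_l ∈ R` of order `σ l` and take `b` to be the tuple of the classes of
`1 ⊗ g_l`, `l ≤ n`.  The vector `Φ (1 ⊗ g)` of a series of order `s` is `x ^ s` times a vector whose
constant term is a multiple of `(s ^ j)_j`; a Vandermonde determinant therefore shows that the matrix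
of `Φ ∘ b` is the diagonal matrix of the `x ^ σ l` times an invertible matrix over `k⟦x⟧`.  Every
element of `R` is a `k`-combination of the `g_l` up to a term of order at least `σ (n + 1)`, so the
coordinates of `1 ⊗ g` are constants plus multiples of `x ^ (σ (n + 1) - σ n)`
(`Conductor.frameCoord_mem`), and the last coordinate of `1 ⊗ g_{n + 1}` has order exactly
`σ (n + 1) - σ n` (`Conductor.isUnit_vecMul_last`).

*Conclusion.* The condition `s_n - 1 ∈ S` says that `σ (n + 1) = σ n + 1`. If it holds, the ring of
any chart contains an element with a pole, and is then all of `K`, or it contains an element of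
order one and no poles, and is then `k⟦x⟧`. If it fails, then `1 ∉ S`, so neither the
elements of `R` nor the coordinates in the adapted chart have terms of degree one, and the ring of
this chart has no element of order one; its localization at the prime of the elements of positive order
has dimension at most one, and were it regular, the orders of its elements would be the multiples of
some `q ≥ 2`, although it contains `x ^ c` and `x ^ (c + 1)` (`not_isRegularLocalRing`).
-/

noncomputable section

namespace NashBlowup

/-! ### Regularity of a reduced closed subscheme in terms of charts -/

section Regular

/-- All localizations of `A` at primes are regular.  Unlike in `IsRegularRing`, the ring `A` itself
is not required to be Noetherian. -/
def HasRegularLocalizations (A : Type u) [CommRing A] : Prop :=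
  ∀ (p : Ideal A) [p.IsPrime], IsRegularLocalRing (Localization.AtPrime p)

theorem HasRegularLocalizations.of_ringEquiv {A B : Type u} [CommRing A] [CommRing B] (e : A ≃+* B)
    (h : HasRegularLocalizations A) : HasRegularLocalizations B := by
  intro p hp
  have := h (p.comap e)
  exact IsRegularLocalRing.of_ringEquiv <| IsLocalization.ringEquivOfRingEquiv
    (Localization.AtPrime (p.comap e)) (Localization.AtPrime p) e (e.map_primeCompl_comap_eq p)

theorem HasRegularLocalizations.iff_of_ringEquiv {A B : Type u} [CommRing A] [CommRing B]
    (e : A ≃+* B) : HasRegularLocalizations A ↔ HasRegularLocalizations B :=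
  ⟨.of_ringEquiv e, .of_ringEquiv e.symm⟩

theorem isRegularScheme_spec (A : Type u) [CommRing A] :
    IsRegularScheme (Spec (CommRingCat.of A)) ↔ HasRegularLocalizations A := by
  have key (x : PrimeSpectrum A) : Nonempty (Localization.AtPrime x.asIdeal ≃+*
      (Spec (CommRingCat.of A)).presheaf.stalk x) :=
    ⟨(AlgebraicGeometry.Spec.stalkIso (CommRingCat.of A) x).commRingCatIsoToRingEquiv.symm⟩
  refine ⟨fun h p hp => ?_, fun h x => ?_⟩
  · have := h (⟨p, hp⟩ : PrimeSpectrum A)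
    exact IsRegularLocalRing.of_ringEquiv (key ⟨p, hp⟩).some.symm
  · have hx : (PrimeSpectrum.asIdeal (R := A) x).IsPrime := PrimeSpectrum.isPrime x
    have := h (PrimeSpectrum.asIdeal (R := A) x)
    exact IsRegularLocalRing.of_ringEquiv (key x).some

theorem isRegularScheme_iff_of_openImmersions {X : Scheme.{u}} {ι : Type*} {Y : ι → Scheme.{u}}
    (f : ∀ i, Y i ⟶ X) [∀ i, IsOpenImmersion (f i)] (hf : ∀ x, ∃ i, x ∈ Set.range (f i)) :
    IsRegularScheme X ↔ ∀ i, IsRegularScheme (Y i) := by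
  have key (i) (y : Y i) : Nonempty (X.presheaf.stalk (f i y) ≃+* (Y i).presheaf.stalk y) :=
    ⟨(asIso ((f i).stalkMap y)).commRingCatIsoToRingEquiv⟩
  refine ⟨fun h i y => ?_, fun h x => ?_⟩
  · have := h (f i y)
    exact .of_ringEquiv (key i y).some
  · obtain ⟨i, y, rfl⟩ := hf x
    have := h i y
    exact .of_ringEquiv (key i y).some.symm

/-- A closed set with its reduced scheme structure is regular if and only if its pieces in
the charts of an affine open cover are. -/
theorem isRegularScheme_vanishingIdeal_iff {X : Scheme.{u}} (Z : Closeds X) {ι : Type*}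
    {A : ι → Type u} [∀ i, CommRing (A i)] (f : ∀ i, Spec (CommRingCat.of (A i)) ⟶ X)
    [∀ i, IsOpenImmersion (f i)] (hf : ∀ x, ∃ i, x ∈ Set.range (f i)) :
    IsRegularScheme (Scheme.IdealSheafData.vanishingIdeal Z).subscheme ↔
      ∀ i, HasRegularLocalizations (A i ⧸
        PrimeSpectrum.vanishingIdeal {x : PrimeSpectrum (A i) | f i x ∈ Z}) := by
  set I := Scheme.IdealSheafData.vanishingIdeal Z with hI
  let U (i : ι) : X.affineOpens := ⟨(f i).opensRange, isAffineOpen_opensRange (f i)⟩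
  have (i : ι) : IsOpenImmersion (I.subschemeCover.f (U i)) := I.subschemeCover.map_prop _
  rw [isRegularScheme_iff_of_openImmersions (fun i => I.subschemeCover.f (U i))]
  · refine forall_congr' fun i => ?_
    rw [show I.subschemeCover.X (U i) = CommRingCat.of (Γ(X, U i) ⧸ I.ideal (U i)) from rfl]
    rw [isRegularScheme_spec]
    have hU : IsAffineOpen (U i).1 := (U i).2
    have hle : (⊤ : (Spec (CommRingCat.of (A i))).Opens) ≤ (f i) ⁻¹ᵁ (U i).1 := by
      intro x _
      exact ⟨x, rfl⟩
    let h : Γ(X, U i) ⟶ CommRingCat.of (A i) :=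
      (f i).appLE (U i).1 ⊤ hle ≫ (Scheme.ΓSpecIso _).hom
    have hcomp : Spec.map h ≫ hU.fromSpec = f i := by
      rw [Spec.map_comp, Category.assoc,
        IsAffineOpen.SpecMap_appLE_fromSpec (f i) hU (isAffineOpen_top _),
        IsAffineOpen.fromSpec_top]
      simp [Scheme.isoSpec_Spec_inv]
    have hcomp' (x) : hU.fromSpec (Spec.map h x) = f i x := by
      rw [← Scheme.Hom.comp_apply, hcomp]
    have hs : Function.Surjective (Spec.map h) := by
      intro y
      have : hU.fromSpec y ∈ Set.range (f i) := by
        have := Set.mem_range_self (f := hU.fromSpec) y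
        rw [IsAffineOpen.range_fromSpec] at this
        exact this
      obtain ⟨x, hx⟩ := this
      exact ⟨x, hU.fromSpec.isOpenEmbedding.injective ((hcomp' x).trans hx)⟩
    have : IsIso h := by
      have : IsIso (Spec.map h) := by
        have h1 : IsOpenImmersion (Spec.map h) := by
          have : IsOpenImmersion (Spec.map h ≫ hU.fromSpec) := by rw [hcomp]; infer_instance
          exact IsOpenImmersion.of_comp _ hU.fromSpec
        have h2 : Epi (Spec.map h).base := (TopCat.epi_iff_surjective _).2 hs
        exact IsOpenImmersion.isIso _
      have : IsIso (Scheme.Spec.map h.op) := this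
      have := isIso_of_reflects_iso h.op Scheme.Spec
      exact isIso_of_op h
    let e : Γ(X, U i) ≃+* A i := (asIso h).commRingCatIsoToRingEquiv
    refine HasRegularLocalizations.iff_of_ringEquiv (Ideal.quotientEquiv _ _ e ?_)
    have hcomap : I.ideal (U i) = Ideal.comap (e : Γ(X, U i) →+* A i)
        (PrimeSpectrum.vanishingIdeal {x : PrimeSpectrum (A i) | f i x ∈ Z}) := by
      ext a
      rw [hI, Scheme.IdealSheafData.vanishingIdeal_ideal, Ideal.mem_comap,
        PrimeSpectrum.mem_vanishingIdeal, PrimeSpectrum.mem_vanishingIdeal]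
      refine ⟨fun H x hx => ?_, fun H y hy => ?_⟩
      · refine H (Spec.map h x) ?_
        exact (congrArg (· ∈ Z) (hcomp' x)).mpr hx
      · obtain ⟨x, rfl⟩ := hs y
        refine H x ?_
        exact (congrArg (· ∈ Z) (hcomp' x)).mp hy
    rw [hcomap]
    exact (Ideal.map_comap_of_surjective (e : Γ(X, U i) →+* A i) e.surjective _).symm
  · intro x
    obtain ⟨i, hi⟩ := hf (I.subschemeι x)
    refine ⟨i, ?_⟩
    have := I.opensRange_subschemeCover_map (U i)
    have hx : x ∈ I.subschemeι ⁻¹ᵁ (U i).1 := hi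
    rw [← this] at hx
    exact hx

end Regular

/-! ### The charts of a Nash blowup over a domain -/

section Charts

variable {R : Type u} [CommRing R] {M : Type u} [AddCommGroup M] [Module R M] {r : ℕ}

theorem ChartRing.induction {b : Fin r → M} {motive : ChartRing R b → Prop}
    (algebraMap : ∀ a : R, motive (algebraMap R _ a)) (coord : ∀ m i, motive (coord b m i))
    (mul : ∀ x y, motive x → motive y → motive (x * y))
    (add : ∀ x y, motive x → motive y → motive (x + y)) (x : ChartRing R b) : motive x := by
  obtain ⟨x, rfl⟩ := Ideal.Quotient.mk_surjective x
  induction x using SymmetricAlgebra.induction with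
  | algebraMap a => exact algebraMap a
  | ι v =>
    have hv : v = ∑ i, Pi.single i (v i) := (Finset.univ_sum_single v).symm
    rw [hv, map_sum, map_sum]
    refine Finset.sum_induction _ motive (fun x y => add x y) ?_ (fun i _ => coord (v i) i)
    simpa using algebraMap 0
  | mul x y hx hy => rw [map_mul]; exact mul _ _ hx hy
  | add x y hx hy => rw [map_add]; exact add _ _ hx hy

/-- At a point of the locus where `M` is locally free of rank `r`, the module is generated by `r`
elements up to denominators. -/
theorem exists_generators_of_mem_freeRankLocus (hr : 0 < r) {p : PrimeSpectrum R}
    (hp : p ∈ freeRankLocus R M r) :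
    ∃ m : Fin r → M, ∀ x : M, ∃ s ∉ p.asIdeal, s • x ∈ Submodule.span R (Set.range m) := by
  obtain ⟨hfree, hrank⟩ := hp
  have : Module.Free (Localization.AtPrime p.asIdeal) (LocalizedModule p.asIdeal.primeCompl M) :=
    hfree
  have hrank' : Module.finrank (Localization.AtPrime p.asIdeal)
    (LocalizedModule p.asIdeal.primeCompl M) = r := hrank
  have : Module.Finite (Localization.AtPrime p.asIdeal)
      (LocalizedModule p.asIdeal.primeCompl M) :=
    Module.finite_of_finrank_pos (by omega)
  let e := Module.finBasisOfFinrankEq (Localization.AtPrime p.asIdeal)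
      (LocalizedModule p.asIdeal.primeCompl M) hrank'
  let f := LocalizedModule.mkLinearMap p.asIdeal.primeCompl M
  choose ms hms using fun i => IsLocalizedModule.surj p.asIdeal.primeCompl f (e i)
  refine ⟨fun i => (ms i).1, fun x => ?_⟩
  -- All elements of the localization are fractions of elements of the span
  have key (y : LocalizedModule p.asIdeal.primeCompl M) : ∃ s : p.asIdeal.primeCompl,
      s • y ∈ (Submodule.span R (Set.range fun i => (ms i).1)).map f := by
    have hy : y ∈ Submodule.span (Localization.AtPrime p.asIdeal) (Set.range e) := by
      rw [e.span_eq]; trivial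
    induction hy using Submodule.span_induction with
    | mem y hy =>
      obtain ⟨i, rfl⟩ := hy
      exact ⟨(ms i).2, by rw [hms]; exact Submodule.mem_map_of_mem (Submodule.subset_span ⟨i, rfl⟩)⟩
    | zero => exact ⟨1, by simp⟩
    | add y z _ _ hy hz =>
      obtain ⟨s, hs⟩ := hy
      obtain ⟨t, ht⟩ := hz
      refine ⟨s * t, ?_⟩
      rw [smul_add, mul_smul, smul_comm, mul_smul]
      exact add_mem (Submodule.smul_of_tower_mem _ (t : R) hs)
        (Submodule.smul_of_tower_mem _ (s : R) ht)
    | smul c y _ hy =>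
      obtain ⟨s, hs⟩ := hy
      obtain ⟨a, t, rfl⟩ := IsLocalization.exists_mk'_eq p.asIdeal.primeCompl c
      refine ⟨s * t, ?_⟩
      have : (s * t) • (IsLocalization.mk' (Localization.AtPrime p.asIdeal) a t) • y =
          a • s • y := by
        rw [mul_comm, mul_smul, smul_comm s, Submonoid.smul_def t,
          ← algebraMap_smul (Localization.AtPrime p.asIdeal) (t : R),
          ← algebraMap_smul (Localization.AtPrime p.asIdeal) a, smul_smul, mul_comm,
          IsLocalization.mk'_spec]
      rw [this]
      exact Submodule.smul_mem _ _ hs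
  obtain ⟨s, z, hz, hzs⟩ := key (f x)
  have : f z = f (s • x) := by rw [hzs]; exact (f.map_smul (s : R) x).symm
  obtain ⟨t, ht⟩ := IsLocalizedModule.exists_of_eq (S := p.asIdeal.primeCompl) this
  refine ⟨(t * s : p.asIdeal.primeCompl), (t * s).2, ?_⟩
  have h2 : ((t * s : p.asIdeal.primeCompl) : R) • x = (t : R) • z := by
    rw [Submonoid.coe_mul, mul_smul]; exact ht.symm
  rw [h2]
  exact Submodule.smul_mem _ _ hz

/-- Over a point of the chart of `b` lying in the locally free locus of rank `r`, the tuple `b`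
generates `M` up to denominators: its matrix with respect to a basis has unit determinant, as
the universal quotient sends `b` to a basis. -/
theorem span_of_comap_mem_freeRankLocus (hr : 0 < r) {b : Fin r → M} (q : Ideal (ChartRing R b))
    [hq : q.IsPrime] (hp : PrimeSpectrum.comap (algebraMap R (ChartRing R b)) ⟨q, hq⟩ ∈
      freeRankLocus R M r) (x : M) :
    ∃ s : R, algebraMap R (ChartRing R b) s ∉ q ∧ s • x ∈ Submodule.span R (Set.range b) := by
  obtain ⟨m, hm⟩ := exists_generators_of_mem_freeRankLocus hr hp
  replace hm : ∀ x : M, ∃ s : R, algebraMap R (ChartRing R b) s ∉ q ∧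
    s • x ∈ Submodule.span R (Set.range m) := hm
  choose s hs hsb using fun j => hm (b j)
  simp only [Submodule.mem_span_range_iff_exists_fun] at hsb
  choose B hB using hsb
  -- `B` expresses `diag s • b` in terms of `m`
  let B' : Matrix (Fin r) (Fin r) R := Matrix.of B
  have hdet : algebraMap R (ChartRing R b) B'.det ∉ q := by
    let C : Matrix (Fin r) (Fin r) (ChartRing R b) := Matrix.of fun i l => coord b (m i) l
    have hmul : (algebraMap R (ChartRing R b)).mapMatrix B' * C =
        Matrix.diagonal fun j => algebraMap R (ChartRing R b) (s j) := by
      ext j l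
      have := congrArg (fun y => coord (R := R) b y l) (hB j)
      simp only [map_sum, map_smul, Finset.sum_apply, Pi.smul_apply, coord_self] at this
      rw [Matrix.mul_apply]
      simp only [B', C, RingHom.mapMatrix_apply, Matrix.map_apply, Matrix.of_apply,
        ← Algebra.smul_def, this, Matrix.diagonal_apply]
      by_cases h : j = l
      · subst h
        rw [Pi.single_eq_same, if_pos rfl]
        exact (Algebra.algebraMap_eq_smul_one _).symm
      · simp [h, Ne.symm h]
    intro hmem
    have h2 := congrArg Matrix.det hmul
    rw [Matrix.det_mul, Matrix.det_diagonal, ← RingHom.map_det] at h2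
    have h3 : ∏ j, algebraMap R (ChartRing R b) (s j) ∈ q := by
      rw [← h2]; exact q.mul_mem_right _ hmem
    obtain ⟨j, _, hj⟩ := (hq.prod_mem_iff).1 h3
    exact hs j hj
  have hspan (l : Fin r) : B'.det • m l ∈ Submodule.span R (Set.range b) := by
    have : B'.det • m l = ∑ j, B'.adjugate l j • s j • b j := by
      have h1 := Matrix.adjugate_mul B'
      simp_rw [← hB, Finset.smul_sum, smul_smul]
      rw [Finset.sum_comm]
      simp_rw [← Finset.sum_smul]
      have h2 (i : Fin r) : ∑ j, B'.adjugate l j * B j i = if l = i then B'.det else 0 := by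
        have := congrFun (congrFun h1 l) i
        rw [Matrix.mul_apply] at this
        simpa [Matrix.one_apply, B'] using this
      simp [h2]
    rw [this]
    exact Submodule.sum_mem _ fun j _ => Submodule.smul_mem _ _ (Submodule.smul_mem _ _
      (Submodule.subset_span ⟨j, rfl⟩))
  obtain ⟨t, ht, htx⟩ := hm x
  refine ⟨B'.det * t, ?_, ?_⟩
  · rw [map_mul]
    exact fun h => (hq.mem_or_mem h).elim hdet ht
  · rw [mul_smul]
    obtain ⟨c, hc⟩ := (Submodule.mem_span_range_iff_exists_fun R).1 htx
    rw [← hc, Finset.smul_sum]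
    refine Submodule.sum_mem _ fun l _ => ?_
    rw [smul_comm]
    exact Submodule.smul_mem _ _ (hspan l)

/-- Over the locally free locus the chart of `b` is, up to denominators, the base itself. -/
theorem exists_smul_eq_algebraMap (hr : 0 < r) {b : Fin r → M} (q : Ideal (ChartRing R b))
    [hq : q.IsPrime] (hp : PrimeSpectrum.comap (algebraMap R (ChartRing R b)) ⟨q, hq⟩ ∈
      freeRankLocus R M r) (x : ChartRing R b) :
    ∃ s a : R, algebraMap R (ChartRing R b) s ∉ q ∧
      algebraMap R (ChartRing R b) s * x = algebraMap R (ChartRing R b) a := by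
  induction x using ChartRing.induction with
  | algebraMap a => exact ⟨1, a, by simpa using hq.one_notMem, by simp⟩
  | coord m i =>
    obtain ⟨s, hs, hm⟩ := span_of_comap_mem_freeRankLocus hr q hp m
    obtain ⟨c, hc⟩ := (Submodule.mem_span_range_iff_exists_fun R).1 hm
    refine ⟨s, c i, hs, ?_⟩
    have := congrArg (fun y => coord (R := R) b y i) hc
    simp only [map_sum, map_smul, Finset.sum_apply, Pi.smul_apply, coord_self] at this
    rw [← Algebra.smul_def, ← this, Finset.sum_eq_single i]
    · rw [Pi.single_eq_same]
      exact (Algebra.algebraMap_eq_smul_one _).symm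
    · intro j _ hj
      simp [Ne.symm hj]
    · simp
  | mul x y hx hy =>
    obtain ⟨s, a, hs, hx⟩ := hx
    obtain ⟨t, c, ht, hy⟩ := hy
    refine ⟨s * t, a * c, ?_, ?_⟩
    · rw [map_mul]
      exact fun h => (hq.mem_or_mem h).elim hs ht
    · rw [map_mul, map_mul, mul_mul_mul_comm, hx, hy]
  | add x y hx hy =>
    obtain ⟨s, a, hs, hx⟩ := hx
    obtain ⟨t, c, ht, hy⟩ := hy
    refine ⟨s * t, t * a + s * c, ?_, ?_⟩
    · rw [map_mul]
      exact fun h => (hq.mem_or_mem h).elim hs ht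
    · rw [map_mul, map_add, map_mul, map_mul, ← hx, ← hy]
      ring

end Charts

section ChartInclusion

variable (R : Type u) [CommRing R] {M : Type u} [AddCommGroup M] [Module R M] {r : ℕ}

/-- The inclusion of the chart of `b` in the Grassmannian. -/
def chartι (b : Fin r → M) : chart R b ⟶ grassmannian R M r :=
  (grassmannianGlueData R M r).ι b

instance (b : Fin r → M) : IsOpenImmersion (chartι R b) :=
  (grassmannianGlueData R M r).ι_isOpenImmersion b

theorem chartι_jointly_surjective (x : grassmannian R M r) :
    ∃ b : Fin r → M, x ∈ Set.range (chartι R b) :=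
  (grassmannianGlueData R M r).ι_jointly_surjective x

theorem chartι_comp (b : Fin r → M) : chartι R b ≫ grassmannianπ R M r =
    Spec.map (CommRingCat.ofHom (algebraMap R (ChartRing R b))) :=
  Multicoequalizer.π_desc _ _ _ _ _

end ChartInclusion

section GenericFibre

variable {R : Type u} [CommRing R] {K : Type u} [Field K] [Algebra R K]
  {M : Type u} [AddCommGroup M] [Module R M] {r : ℕ}

/-- The matrix whose rows are the images of the tuple `b` in `K ^ r`. -/
def frameMatrix (Φ : M →ₗ[R] (Fin r → K)) (b : Fin r → M) : Matrix (Fin r) (Fin r) K :=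
  Matrix.of fun j => Φ (b j)

/-- The coordinates of the elements of `M` with respect to the images of the tuple `b` in `K ^ r`
(meaningful if these form a basis). -/
def frameCoord (Φ : M →ₗ[R] (Fin r → K)) (b : Fin r → M) : M →ₗ[R] (Fin r → K) :=
  (Matrix.vecMulLinear (frameMatrix Φ b)⁻¹).restrictScalars R ∘ₗ Φ

theorem frameCoord_apply (Φ : M →ₗ[R] (Fin r → K)) (b : Fin r → M) (m : M) :
    frameCoord Φ b m = Matrix.vecMul (Φ m) (frameMatrix Φ b)⁻¹ := rfl

theorem frameCoord_self {Φ : M →ₗ[R] (Fin r → K)} {b : Fin r → M}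
    (hb : IsUnit (frameMatrix Φ b).det) (j : Fin r) : frameCoord Φ b (b j) = Pi.single j 1 := by
  rw [frameCoord_apply, show Φ (b j) = Matrix.vecMul (Pi.single j 1) (frameMatrix Φ b) by
    ext i; simp [frameMatrix], Matrix.vecMul_vecMul, Matrix.mul_nonsing_inv _ hb, Matrix.vecMul_one]

/-- The ring homomorphism from the chart of `b` to `K` whose kernel is the generic point of the
Nash blowup, if the images of `b` in `K ^ r` form a basis. -/
def chartToField (Φ : M →ₗ[R] (Fin r → K)) (b : Fin r → M) (hb : IsUnit (frameMatrix Φ b).det) :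
    ChartRing R b →ₐ[R] K :=
  chartLift b (frameCoord Φ b) (frameCoord_self hb)

/-- If `b` generates `M` up to denominators, then its images in `K ^ r` form a basis. -/
theorem isUnit_det_frameMatrix {Φ : M →ₗ[R] (Fin r → K)}
    (hspan : Submodule.span K (Set.range Φ) = ⊤) {b : Fin r → M}
    (h : ∀ m, ∃ s : R, algebraMap R K s ≠ 0 ∧ s • m ∈ Submodule.span R (Set.range b)) :
    IsUnit (frameMatrix Φ b).det := by
  have hb : Submodule.span K (Set.range (Φ ∘ b)) = ⊤ := by
    rw [eq_top_iff, ← hspan, Submodule.span_le]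
    rintro _ ⟨m, rfl⟩
    obtain ⟨s, hs, hm⟩ := h m
    obtain ⟨c, hc⟩ := (Submodule.mem_span_range_iff_exists_fun R).1 hm
    have h1 : algebraMap R K s • Φ m ∈ Submodule.span K (Set.range (Φ ∘ b)) := by
      rw [algebraMap_smul, ← map_smul, ← hc, map_sum]
      refine Submodule.sum_mem _ fun i _ => ?_
      rw [map_smul, ← algebraMap_smul K]
      exact Submodule.smul_mem _ _ (Submodule.subset_span ⟨i, rfl⟩)
    have h2 := Submodule.smul_mem _ (algebraMap R K s)⁻¹ h1
    rwa [smul_smul, inv_mul_cancel₀ hs, one_smul] at h2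
  have h1 (l : Fin r) : ∃ c : Fin r → K, ∑ j, c j • Φ (b j) = Pi.single l 1 := by
    have : (Pi.single l 1 : Fin r → K) ∈ Submodule.span K (Set.range (Φ ∘ b)) := by
      rw [hb]; trivial
    exact (Submodule.mem_span_range_iff_exists_fun K).1 this
  choose N hN using h1
  refine Matrix.isUnit_det_of_left_inverse (B := Matrix.of N) ?_
  ext l i
  have := congrFun (hN l) i
  rw [Finset.sum_apply] at this
  rw [Matrix.mul_apply, Matrix.one_apply]
  simp only [Pi.single_apply] at this
  simpa only [frameMatrix, Matrix.of_apply, smul_eq_mul, Pi.smul_apply, eq_comm] using this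

variable [IsDomain R] [IsFractionRing R K]

/-- A linear map to `K ^ r` with torsion kernel and spanning image is the localization at the
generic point. -/
theorem isLocalizedModule_of_torsion_ker {Φ : M →ₗ[R] (Fin r → K)}
    (hspan : Submodule.span K (Set.range Φ) = ⊤)
    (hker : ∀ m, Φ m = 0 → ∃ a : R, a ≠ 0 ∧ a • m = 0) :
    IsLocalizedModule (nonZeroDivisors R) Φ where
  map_units s := by
    have hs : algebraMap R K s ≠ 0 := by
      simp
    refine (Module.End.isUnit_iff _).2 ⟨fun v w h => ?_, fun v => ⟨(algebraMap R K s)⁻¹ • v, ?_⟩⟩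
    · simp only [Module.algebraMap_end_apply] at h
      rw [← algebraMap_smul K, ← algebraMap_smul K (s : R) w] at h
      exact smul_right_injective _ hs h
    · rw [Module.algebraMap_end_apply, ← algebraMap_smul K, smul_smul, mul_inv_cancel₀ hs,
        one_smul]
  surj v := by
    have hv : v ∈ Submodule.span K (Set.range Φ) := by rw [hspan]; trivial
    induction hv using Submodule.span_induction with
    | mem y hy =>
      obtain ⟨m, rfl⟩ := hy
      exact ⟨(m, 1), by simp⟩
    | zero => exact ⟨(0, 1), by simp⟩
    | add y z _ _ hy hz =>
      obtain ⟨⟨m, s⟩, hs⟩ := hy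
      obtain ⟨⟨n, t⟩, ht⟩ := hz
      refine ⟨(t • m + s • n, s * t), ?_⟩
      dsimp only at hs ht ⊢
      rw [smul_add, mul_smul, mul_smul, smul_comm, hs, ht, map_add]
      simp only [Submonoid.smul_def, map_smul]
    | smul c y _ hy =>
      obtain ⟨⟨m, s⟩, hs⟩ := hy
      obtain ⟨a, t, rfl⟩ := IsLocalization.exists_mk'_eq (nonZeroDivisors R) c
      refine ⟨(a • m, s * t), ?_⟩
      dsimp only at hs ⊢
      rw [map_smul, ← hs, mul_comm, mul_smul, smul_comm s, Submonoid.smul_def t,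
        ← algebraMap_smul K (t : R), ← algebraMap_smul K a, smul_smul, mul_comm,
        IsLocalization.mk'_spec]
  exists_of_eq {x y} h := by
    obtain ⟨a, ha, hm⟩ := hker (x - y) (by rw [map_sub, h, sub_self])
    refine ⟨⟨a, mem_nonZeroDivisors_of_ne_zero ha⟩, ?_⟩
    rwa [smul_sub, sub_eq_zero] at hm

theorem bot_mem_freeRankLocus {Φ : M →ₗ[R] (Fin r → K)}
    (hspan : Submodule.span K (Set.range Φ) = ⊤)
    (hker : ∀ m, Φ m = 0 → ∃ a : R, a ≠ 0 ∧ a • m = 0) :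
    (⊥ : PrimeSpectrum R) ∈ freeRankLocus R M r := by
  have h := isLocalizedModule_of_torsion_ker hspan hker
  have hbot : (⊥ : PrimeSpectrum R).asIdeal.primeCompl = nonZeroDivisors R := by
    exact Ideal.primeCompl_bot
  have hle : (⊥ : PrimeSpectrum R).asIdeal.primeCompl ≤ nonZeroDivisors R := hbot.le
  constructor
  · have : IsLocalization.AtPrime K (⊥ : PrimeSpectrum R).asIdeal := by
      rw [IsLocalization.AtPrime, hbot]; infer_instance
    have : IsLocalizedModule (⊥ : PrimeSpectrum R).asIdeal.primeCompl Φ := by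
      rwa [hbot]
    rw [Module.mem_freeLocus_of_isLocalization _ K (Fin r → K) Φ]
    infer_instance
  · rw [Module.rankAtStalk, IsLocalization.finrank_eq (R := R) _ _ hle,
      IsLocalizedModule.finrank_eq _ (LocalizedModule.mkLinearMap _ M) hle,
      ← IsLocalizedModule.finrank_eq _ Φ le_rfl,
      ← IsLocalization.finrank_eq K (nonZeroDivisors R) le_rfl]
    simp

/-- The part of the Nash blowup in the chart of `b`: the closure of the generic point if `b` is
generically a basis, and empty otherwise. -/
theorem mem_nashSet_iff (hr : 0 < r) {Φ : M →ₗ[R] (Fin r → K)}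
    (hspan : Submodule.span K (Set.range Φ) = ⊤)
    (hker : ∀ m, Φ m = 0 → ∃ a : R, a ≠ 0 ∧ a • m = 0) (b : Fin r → M)
    (q : PrimeSpectrum (ChartRing R b)) :
    chartι R b q ∈ nashSet R M r ↔
      ∃ hb : IsUnit (frameMatrix Φ b).det, RingHom.ker (chartToField Φ b hb) ≤ q.asIdeal := by
  have hinj : Function.Injective (algebraMap R K) := IsFractionRing.injective R K
  let V : Set (PrimeSpectrum (ChartRing R b)) :=
    PrimeSpectrum.comap (algebraMap R (ChartRing R b)) ⁻¹' freeRankLocus R M r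
  have hV (x : PrimeSpectrum (ChartRing R b)) (hx : x ∈ V) :
      ∃ hb : IsUnit (frameMatrix Φ b).det, RingHom.ker (chartToField Φ b hb) ≤ x.asIdeal := by
    have hb : IsUnit (frameMatrix Φ b).det := by
      refine isUnit_det_frameMatrix hspan fun m => ?_
      obtain ⟨s, hs, hm⟩ := span_of_comap_mem_freeRankLocus hr x.asIdeal hx m
      refine ⟨s, fun h => hs ?_, hm⟩
      rw [map_eq_zero_iff _ hinj] at h
      rw [h, map_zero]
      exact zero_mem _
    refine ⟨hb, fun a ha => ?_⟩
    obtain ⟨s, c, hs, hsc⟩ := exists_smul_eq_algebraMap hr x.asIdeal hx a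
    rw [RingHom.mem_ker] at ha
    have h1 := congrArg (chartToField Φ b hb) hsc
    rw [map_mul, ha, mul_zero, AlgHom.commutes, eq_comm, map_eq_zero_iff _ hinj] at h1
    rw [h1, map_zero] at hsc
    have : algebraMap R (ChartRing R b) s * a ∈ x.asIdeal := by rw [hsc]; exact zero_mem _
    exact (x.isPrime.mem_or_mem this).resolve_left hs
  have hpre : chartι R b ⁻¹'
    (nashSet R M r : Set (grassmannian R M r)) = closure V := by
    have h1 := (chartι R b).isOpenEmbedding
    change _ ⁻¹' closure _ = _
    rw [h1.isOpenMap.preimage_closure_eq_closure_preimage h1.continuous]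
    congr 1
    ext x
    have h2 : grassmannianπ R M r (chartι R b x) =
        PrimeSpectrum.comap (algebraMap R (ChartRing R b)) x := by
      rw [← Scheme.Hom.comp_apply, chartι_comp]
      rfl
    exact (congrArg (· ∈ freeRankLocus R M r) h2).to_iff
  change q ∈ chartι R b ⁻¹'
    (nashSet R M r : Set (grassmannian R M r)) ↔ _
  rw [hpre]
  refine ⟨fun hq => ?_, fun ⟨hb, hq⟩ => ?_⟩
  · by_cases hb : IsUnit (frameMatrix Φ b).det
    · refine ⟨hb, ?_⟩
      have : V ⊆ PrimeSpectrum.zeroLocus (RingHom.ker (chartToField Φ b hb) : Set _) :=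
        fun x hx => (hV x hx).2
      exact (closure_minimal this (PrimeSpectrum.isClosed_zeroLocus _)) hq
    · have : V = ∅ := Set.eq_empty_of_forall_notMem fun x hx => hb (hV x hx).1
      rw [this, closure_empty] at hq
      exact hq.elim
  · let x : PrimeSpectrum (ChartRing R b) :=
      ⟨RingHom.ker (chartToField Φ b hb), RingHom.ker_isPrime _⟩
    have hx : x ∈ V := by
      have : PrimeSpectrum.comap (algebraMap R (ChartRing R b)) x = ⊥ := by
        ext a
        simp only [PrimeSpectrum.comap_asIdeal, Ideal.mem_comap, x, RingHom.mem_ker,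
          AlgHom.commutes, PrimeSpectrum.asIdeal_bot, Ideal.mem_bot]
        exact map_eq_zero_iff _ hinj
      change PrimeSpectrum.comap (algebraMap R (ChartRing R b)) x ∈ freeRankLocus R M r
      rw [this]
      exact bot_mem_freeRankLocus hspan hker
    have h1 : x ⤳ q := (PrimeSpectrum.le_iff_specializes x q).1 hq
    exact h1.mem_closed isClosed_closure (subset_closure hx)

/-- The Nash blowup is regular if and only if the coordinate rings of its charts, which are
subrings of the function field `K`, are regular. -/
theorem isRegularScheme_nash_iff (hr : 0 < r) {Φ : M →ₗ[R] (Fin r → K)}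
    (hspan : Submodule.span K (Set.range Φ) = ⊤)
    (hker : ∀ m, Φ m = 0 → ∃ a : R, a ≠ 0 ∧ a • m = 0) :
    IsRegularScheme (nash R M r) ↔ ∀ (b : Fin r → M) (hb : IsUnit (frameMatrix Φ b).det),
      HasRegularLocalizations (chartToField Φ b hb).range := by
  refine (isRegularScheme_vanishingIdeal_iff (nashSet R M r)
    (A := fun b : Fin r → M => ChartRing R b) (chartι R)
    (chartι_jointly_surjective R)).trans
    (forall_congr' fun b => ?_)
  · have hset : {x : PrimeSpectrum (ChartRing R b) |
        chartι R b x ∈ nashSet R M r} =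
        {x | ∃ hb : IsUnit (frameMatrix Φ b).det,
          RingHom.ker (chartToField Φ b hb) ≤ x.asIdeal} :=
      Set.ext fun q => mem_nashSet_iff hr hspan hker b q
    by_cases hb : IsUnit (frameMatrix Φ b).det
    · have hI : PrimeSpectrum.vanishingIdeal {x : PrimeSpectrum (ChartRing R b) |
          chartι R b x ∈ nashSet R M r} =
          RingHom.ker (chartToField Φ b hb) := by
        have h1 : {x : PrimeSpectrum (ChartRing R b) | ∃ hb : IsUnit (frameMatrix Φ b).det,
            RingHom.ker (chartToField Φ b hb) ≤ x.asIdeal} =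
            PrimeSpectrum.zeroLocus (RingHom.ker (chartToField Φ b hb) : Set _) :=
          Set.ext fun x => ⟨fun h => h.2, fun h => ⟨hb, h⟩⟩
        rw [hset, h1, PrimeSpectrum.vanishingIdeal_zeroLocus_eq_radical]
        exact (RingHom.ker_isPrime _).radical
      rw [hI]
      rw [HasRegularLocalizations.iff_of_ringEquiv
        (Ideal.quotientKerEquivRange (chartToField Φ b hb)).toRingEquiv]
      exact ⟨fun h _ => h, fun h => h hb⟩
    · have hI : PrimeSpectrum.vanishingIdeal {x : PrimeSpectrum (ChartRing R b) |
          chartι R b x ∈ nashSet R M r} = ⊤ := by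
        rw [hset, PrimeSpectrum.vanishingIdeal_eq_top_iff]
        exact Set.eq_empty_of_forall_notMem fun x hx => hb hx.1
      rw [hI]
      refine ⟨fun _ h => (hb h).elim, fun _ p hp => (hp.ne_top ?_).elim⟩
      rw [Ideal.eq_top_iff_one, Subsingleton.elim (1 : ChartRing R b ⧸ (⊤ : Ideal _)) 0]
      exact zero_mem _

end GenericFibre

/-! ### Power series in two variables and the diagonal -/

section Bivariate

open PowerSeries

theorem eq_of_forall_X_pow_dvd_sub {A : Type*} [CommRing A] {f g : A⟦X⟧}
    (h : ∀ L, X ^ (L + 1) ∣ f - g) : f = g := by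
  ext a
  have := (X_pow_dvd_iff.1 (h a)) a (Nat.lt_succ_self a)
  rwa [map_sub, sub_eq_zero] at this

variable {k : Type u} [Field k]

/-- The restriction of `H(x, y)`, a power series in `y` over `k⟦x⟧`, to the diagonal `y = x`. -/
def diagFun (H : k⟦X⟧⟦X⟧) : k⟦X⟧ :=
  PowerSeries.mk fun a => coeff a (∑ d ∈ Finset.range (a + 1), coeff d H * X ^ d)

theorem X_pow_dvd_diagFun_sub (H : k⟦X⟧⟦X⟧) (L : ℕ) :
    X ^ L ∣ diagFun H - ∑ d ∈ Finset.range L, coeff d H * X ^ d := by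
  rw [X_pow_dvd_iff]
  intro a ha
  rw [map_sub, diagFun, coeff_mk, sub_eq_zero, map_sum, map_sum]
  refine Finset.sum_subset (fun d hd => ?_) fun d _ hd => ?_
  · rw [Finset.mem_range] at hd ⊢; omega
  · rw [Finset.mem_range] at hd
    rw [coeff_mul_X_pow', if_neg (by omega)]

theorem diagFun_eq {H : k⟦X⟧⟦X⟧} {f : k⟦X⟧}
    (h : ∀ L, X ^ (L + 1) ∣ ∑ d ∈ Finset.range (L + 1), coeff d H * X ^ d - f) :
    diagFun H = f :=
  eq_of_forall_X_pow_dvd_sub fun L => by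
    have := dvd_add (X_pow_dvd_diagFun_sub H (L + 1)) (h L)
    rwa [sub_add_sub_cancel] at this

variable (k) in
/-- The restriction to the diagonal, as an additive map.  There are two `k⟦x⟧`-module structures on
`k⟦x⟧⟦y⟧` in Mathlib, so linearity is stated with `C` instead, see `diagEval_C_mul`. -/
def diagEval : k⟦X⟧⟦X⟧ →+ k⟦X⟧ where
  toFun := diagFun
  map_zero' := diagFun_eq fun L => by simp
  map_add' H G := diagFun_eq fun L => by
    have := dvd_neg.2 (dvd_add (X_pow_dvd_diagFun_sub H (L + 1))
      (X_pow_dvd_diagFun_sub G (L + 1)))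
    convert this using 1
    simp only [map_add, add_mul, Finset.sum_add_distrib]
    ring

theorem X_pow_dvd_diagEval_sub (H : k⟦X⟧⟦X⟧) (L : ℕ) :
    X ^ L ∣ diagEval k H - ∑ d ∈ Finset.range L, coeff d H * X ^ d :=
  X_pow_dvd_diagFun_sub H L

theorem diagEval_C (f : k⟦X⟧) : diagEval k (C f) = f :=
  diagFun_eq fun L => by
    rw [Finset.sum_range_succ']
    simp [coeff_C]

theorem diagEval_C_mul (f : k⟦X⟧) (H : k⟦X⟧⟦X⟧) : diagEval k (C f * H) = f * diagEval k H := by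
  refine diagFun_eq fun L => ?_
  have := dvd_neg.2 (Dvd.dvd.mul_left (X_pow_dvd_diagEval_sub H (L + 1)) f)
  convert this using 1
  simp only [coeff_C_mul, mul_assoc, ← Finset.mul_sum]
  ring

theorem diagEval_X_mul (H : k⟦X⟧⟦X⟧) : diagEval k (X * H) = X * diagEval k H :=
  diagFun_eq fun L => by
    rw [Finset.sum_range_succ']
    have := dvd_neg.2 (mul_dvd_mul_left X (X_pow_dvd_diagEval_sub H L))
    rw [← pow_succ'] at this
    convert this using 1
    simp only [coeff_succ_X_mul, coeff_zero_X_mul, zero_mul, add_zero, mul_sub, Finset.mul_sum,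
      neg_sub]
    congr 1
    refine Finset.sum_congr rfl fun d _ => ?_
    ring

theorem diagEval_map_C (g : k⟦X⟧) : diagEval k (PowerSeries.map C g) = g :=
  diagFun_eq fun L => by
    rw [X_pow_dvd_iff]
    intro a ha
    rw [map_sub, map_sum, Finset.sum_eq_single a]
    · simp [coeff_C_mul]
    · intro d _ hd
      rw [coeff_map, coeff_C_mul, coeff_X_pow, if_neg (Ne.symm hd), mul_zero]
    · intro h
      exact absurd (Finset.mem_range.2 ha) h

variable (k) in
/-- The equation `y - x` of the diagonal. -/
def diagEq : k⟦X⟧⟦X⟧ := X - C X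

theorem diagEval_diagEq_mul (H : k⟦X⟧⟦X⟧) : diagEval k (diagEq k * H) = 0 := by
  rw [diagEq, sub_mul, map_sub, diagEval_X_mul, diagEval_C_mul, sub_self]

/-- A power series vanishing on the diagonal is divisible by `y - x`. -/
theorem diagEq_dvd_of_diagEval_eq_zero {H : k⟦X⟧⟦X⟧} (h : diagEval k H = 0) : diagEq k ∣ H := by
  -- The coefficients of the quotient are the values on the diagonal of the tails of `H`.
  let s (m : ℕ) : k⟦X⟧⟦X⟧ := PowerSeries.mk fun l => coeff (l + m) H
  have hs (m : ℕ) : diagEval k (s m) = coeff m H + X * diagEval k (s (m + 1)) := by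
    have : s m = C (coeff m H) + X * s (m + 1) := by
      ext1 l
      cases l with
      | zero => simp [s]
      | succ l => simp [s, coeff_succ_X_mul, add_assoc, add_comm 1 m]
    rw [this, map_add, diagEval_C, diagEval_X_mul]
  refine ⟨PowerSeries.mk fun m => diagEval k (s (m + 1)), ?_⟩
  ext1 m
  rw [diagEq, sub_mul, map_sub, coeff_C_mul, coeff_mk]
  cases m with
  | zero =>
    have h0 : s 0 = H := by ext1 l; simp [s]
    have := hs 0
    rw [h0, h] at this
    rw [coeff_zero_X_mul, zero_sub, eq_neg_iff_add_eq_zero, ← this]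
  | succ m =>
    rw [coeff_succ_X_mul, coeff_mk, hs (m + 1), add_sub_cancel_right]

/-- The Euler operator `X d/dX`. -/
def euler (A : Type*) [CommRing A] : Derivation A A⟦X⟧ A⟦X⟧ := (X : A⟦X⟧) • derivative A

theorem coeff_euler {A : Type*} [CommRing A] (f : A⟦X⟧) (d : ℕ) :
    coeff d (euler A f) = d * coeff d f := by
  rw [euler, Derivation.smul_apply, smul_eq_mul]
  cases d with
  | zero => simp
  | succ d => rw [coeff_succ_X_mul, coeff_derivative, mul_comm]; push_cast; rfl

theorem coeff_euler_pow {A : Type*} [CommRing A] (f : A⟦X⟧) (j d : ℕ) :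
    coeff d ((euler A)^[j] f) = d ^ j * coeff d f := by
  induction j with
  | zero => simp
  | succ j ih => rw [Function.iterate_succ_apply', coeff_euler, ih, pow_succ']; ring

theorem euler_pow_mul {A : Type*} [CommRing A] (m : ℕ) (f g : A⟦X⟧) :
    euler A (f ^ (m + 1) * g) = f ^ m * ((m + 1) • (euler A f * g) + f * euler A g) := by
  rw [Derivation.leibniz, Derivation.leibniz_pow]
  simp only [smul_eq_mul, nsmul_eq_mul, Nat.add_sub_cancel]
  ring

variable (k) in
/-- The restriction to the diagonal of the `j`-th iterate of `y ∂/∂y`. -/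
def diagJet (j : ℕ) : k⟦X⟧⟦X⟧ →+ k⟦X⟧ where
  toFun H := diagEval k ((euler k⟦X⟧)^[j] H)
  map_zero' := by rw [iterate_map_zero, map_zero]
  map_add' H G := by rw [iterate_map_add, map_add]

theorem diagJet_apply (j : ℕ) (H : k⟦X⟧⟦X⟧) :
    diagJet k j H = diagEval k ((euler k⟦X⟧)^[j] H) := rfl

theorem diagJet_C_mul (j : ℕ) (f : k⟦X⟧) (H : k⟦X⟧⟦X⟧) :
    diagJet k j (C f * H) = f * diagJet k j H := by
  have : (euler k⟦X⟧)^[j] (C f * H) = C f * (euler k⟦X⟧)^[j] H := by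
    ext1 d
    rw [coeff_euler_pow, coeff_C_mul, coeff_C_mul, coeff_euler_pow, mul_left_comm]
  rw [diagJet_apply, diagJet_apply, this, diagEval_C_mul]

theorem diagJet_tensor (j : ℕ) (f g : k⟦X⟧) :
    diagJet k j (C f * PowerSeries.map C g) = f * (euler k)^[j] g := by
  have : (euler k⟦X⟧)^[j] (PowerSeries.map C g) = PowerSeries.map C ((euler k)^[j] g) := by
    ext1 d
    simp [coeff_euler_pow]
  rw [diagJet_C_mul, diagJet_apply, this, diagEval_map_C]

theorem euler_diagEq : euler k⟦X⟧ (diagEq k) = X := by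
  ext1 d
  rw [coeff_euler, diagEq, map_sub, coeff_X, coeff_C]
  by_cases h : d = 1
  · simp [h]
  · by_cases h0 : d = 0 <;> simp [h, h0]

theorem euler_diagEq_pow_mul (m : ℕ) (G : k⟦X⟧⟦X⟧) :
    euler k⟦X⟧ (diagEq k ^ (m + 1) * G) =
      diagEq k ^ m * ((m + 1) • (X * G) + diagEq k * euler k⟦X⟧ G) := by
  rw [euler_pow_mul, euler_diagEq]

theorem diagJet_eq_zero_of_dvd {n : ℕ} {H : k⟦X⟧⟦X⟧} (h : diagEq k ^ (n + 1) ∣ H) {j : ℕ}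
    (hj : j ≤ n) : diagJet k j H = 0 := by
  have key (j m : ℕ) (H) (h : diagEq k ^ (m + j) ∣ H) :
      diagEq k ^ m ∣ (euler k⟦X⟧)^[j] H := by
    induction j generalizing H with
    | zero => exact h
    | succ j ih =>
      rw [Function.iterate_succ_apply]
      obtain ⟨G, rfl⟩ := h
      refine ih _ ?_
      rw [← add_assoc, euler_diagEq_pow_mul]
      exact Dvd.intro _ rfl
  obtain ⟨G, hG⟩ := key j 1 H ((pow_dvd_pow _ (by omega)).trans h)
  rw [diagJet_apply, hG, pow_one, diagEval_diagEq_mul]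

theorem diagJet_diagEq_pow_mul (n : ℕ) (G : k⟦X⟧⟦X⟧) :
    diagJet k n (diagEq k ^ n * G) =
    (n.factorial : k⟦X⟧) * X ^ n * diagEval k G := by
  induction n generalizing G with
  | zero => simp [diagJet_apply]
  | succ n ih =>
    rw [diagJet_apply, Function.iterate_succ_apply, ← diagJet_apply, euler_diagEq_pow_mul, ih,
      map_add, diagEval_diagEq_mul, map_nsmul, diagEval_X_mul, Nat.factorial_succ]
    rw [nsmul_eq_mul, add_zero]
    push_cast
    ring

/-- In characteristic zero, a power series is divisible by `(y - x) ^ (n + 1)` as soon as its first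
`n + 1` derivatives vanish on the diagonal. -/
theorem diagEq_pow_dvd [CharZero k] {n : ℕ} {H : k⟦X⟧⟦X⟧} (h : ∀ j ≤ n, diagJet k j H = 0) :
    diagEq k ^ (n + 1) ∣ H := by
  have key (m : ℕ) (hm : m ≤ n + 1) : diagEq k ^ m ∣ H := by
    induction m with
    | zero => simp
    | succ m ih =>
      obtain ⟨G, hG⟩ := ih (by omega)
      have h1 := h m (by omega)
      rw [hG, diagJet_diagEq_pow_mul] at h1
      have h2 : ((m.factorial : k⟦X⟧) * X ^ m) ≠ 0 := by
        refine mul_ne_zero ?_ (pow_ne_zero _ X_ne_zero)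
        rw [← map_natCast (C (R := k)), Ne, map_eq_zero_iff _ C_injective]
        exact_mod_cast m.factorial_ne_zero
      obtain ⟨G', hG'⟩ := diagEq_dvd_of_diagEval_eq_zero ((mul_eq_zero.1 h1).resolve_left h2)
      rw [hG, hG', pow_succ]
      exact mul_dvd_mul_left _ (Dvd.intro _ rfl)
  exact key _ le_rfl

variable (k) in
/-- The `M`-th power of the maximal ideal of `k⟦x⟧⟦y⟧`, as the ideal of the series whose coefficient
of `y ^ d` is divisible by `x ^ (M - d)` for all `d` (truncated subtraction). -/
def lowOrder (M : ℕ) : Ideal k⟦X⟧⟦X⟧ where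
  carrier := {H | ∀ d, X ^ (M - d) ∣ coeff d H}
  zero_mem' d := by simp
  add_mem' ha hb d := by rw [map_add]; exact dvd_add (ha d) (hb d)
  smul_mem' G H hH d := by
    rw [smul_eq_mul, coeff_mul]
    refine Finset.dvd_sum fun p hp => Dvd.dvd.mul_left ?_ _
    have := Finset.HasAntidiagonal.mem_antidiagonal.1 hp
    exact (pow_dvd_pow _ (by omega)).trans (hH p.2)

theorem lowOrder_mul_le (M N : ℕ) : lowOrder k M * lowOrder k N ≤ lowOrder k (M + N) := by
  rw [Ideal.mul_le]
  intro H hH G hG d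
  rw [coeff_mul]
  refine Finset.dvd_sum fun p hp => ?_
  have := Finset.HasAntidiagonal.mem_antidiagonal.1 hp
  refine (pow_dvd_pow _ ?_).trans ((pow_add _ _ _).dvd.trans (mul_dvd_mul (hH p.1) (hG p.2)))
  omega

theorem lowOrder_one_pow_le (M : ℕ) : lowOrder k 1 ^ M ≤ lowOrder k M := by
  induction M with
  | zero => intro H _ d; simp
  | succ M ih => rw [pow_succ]; exact (Ideal.mul_mono_left ih).trans (lowOrder_mul_le M 1)

theorem eq_of_forall_sub_mem_lowOrder {H G : k⟦X⟧⟦X⟧} (h : ∀ M, H - G ∈ lowOrder k M) :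
    H = G := by
  ext1 d
  refine eq_of_forall_X_pow_dvd_sub fun L => ?_
  have := h (L + 1 + d) d
  rwa [Nat.add_sub_cancel, map_sub] at this

theorem X_pow_dvd_diagJet {M : ℕ} {H : k⟦X⟧⟦X⟧} (h : H ∈ lowOrder k M) (j : ℕ) :
    X ^ M ∣ diagJet k j H := by
  rw [diagJet_apply]
  have h1 := X_pow_dvd_diagEval_sub ((euler k⟦X⟧)^[j] H) M
  refine (dvd_sub_left ?_).1 h1
  refine Finset.dvd_sum fun d hd => ?_
  rw [Finset.mem_range] at hd
  rw [coeff_euler_pow, mul_assoc]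
  refine Dvd.dvd.mul_left ?_ _
  calc (X : k⟦X⟧) ^ M = X ^ (M - d) * X ^ d := by rw [← pow_add]; congr 1; omega
    _ ∣ _ := mul_dvd_mul_right (h d) _

end Bivariate

/-! ### The complete tensor product and power series in two variables -/

section Expansion

open PowerSeries

variable {k A : Type u} [Field k] [CommRing A] [Algebra k A] (i : A →ₐ[k] k⟦X⟧) {m : Ideal A}

/-- The homomorphism `f ⊗ g ↦ f(x) g(y)`. -/
def tensorExpand : A ⊗[k] A →ₐ[k] k⟦X⟧⟦X⟧ :=
  Algebra.TensorProduct.lift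
    { (C : k⟦X⟧ →+* k⟦X⟧⟦X⟧).comp i.toRingHom with
      commutes' := fun c => by simp [PowerSeries.algebraMap_apply] }
    { (PowerSeries.map (C : k →+* k⟦X⟧)).comp i.toRingHom with
      commutes' := fun c => by simp [PowerSeries.algebraMap_apply] }
    fun _ _ => mul_comm _ _

theorem tensorExpand_tmul (f g : A) :
    tensorExpand i (f ⊗ₜ g) = C (i f) * PowerSeries.map C (i g) :=
  Algebra.TensorProduct.lift_tmul _ _ _ _ _

variable {i} in
theorem tensorExpand_mem_lowOrder (hm : ∀ f ∈ m, X ∣ i f) {M : ℕ} {p : A ⊗[k] A}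
    (hp : p ∈ tensorIdeal k m ^ M) : tensorExpand i p ∈ lowOrder k M := by
  have h1 : tensorIdeal k m ≤ (lowOrder k 1).comap (tensorExpand i) := by
    rw [tensorIdeal, sup_le_iff, Ideal.map_le_iff_le_comap, Ideal.map_le_iff_le_comap]
    refine ⟨fun f hf d => ?_, fun f hf d => ?_⟩
    · change _ ∣ coeff d (tensorExpand i (f ⊗ₜ 1))
      rw [tensorExpand_tmul, coeff_C_mul]
      refine Dvd.dvd.mul_right (((pow_dvd_pow X (Nat.sub_le 1 d)).trans ?_)) _
      rw [pow_one]
      exact hm f hf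
    · change _ ∣ coeff d (tensorExpand i (1 ⊗ₜ f))
      rw [tensorExpand_tmul]
      cases d with
      | zero =>
        have := X_dvd_iff.1 (hm f hf)
        simp [this]
      | succ d => simp
  have h2 := Ideal.pow_right_mono h1 M hp
  exact lowOrder_one_pow_le M (Ideal.le_comap_pow (tensorExpand i) M h2)

/-- The reduction of the complete tensor product modulo the `M`-th power of the defining ideal. -/
abbrev truncate (M : ℕ) : CompletedTensor k m →ₐ[A ⊗[k] A]
    (A ⊗[k] A) ⧸ tensorIdeal k m ^ M :=
  AdicCompletion.evalₐ (tensorIdeal k m) M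

theorem exists_truncate_eq (M : ℕ) (F : CompletedTensor k m) :
    ∃ p : A ⊗[k] A, truncate M F = Ideal.Quotient.mk _ p := by
  obtain ⟨p, hp⟩ := Ideal.Quotient.mk_surjective (truncate M F)
  exact ⟨p, hp.symm⟩

theorem truncate_eq_of_le {M N : ℕ} (h : M ≤ N) {F : CompletedTensor k m}
    {p : A ⊗[k] A} (hp : truncate N F = Ideal.Quotient.mk _ p) :
    truncate M F = Ideal.Quotient.mk _ p := by
  induction F using AdicCompletion.induction_on with
  | _ f =>
    rw [truncate, AdicCompletion.evalₐ_mk] at hp ⊢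
    refine (AdicCompletion.Ideal.mk_eq_mk _ h f).symm.trans ?_
    rw [Ideal.Quotient.eq] at hp ⊢
    exact Ideal.pow_le_pow_right h hp

/-- The underlying function of `expand`. -/
def expandFun (F : CompletedTensor k m) : k⟦X⟧⟦X⟧ :=
  PowerSeries.mk fun d => PowerSeries.mk fun a =>
    coeff a (coeff d (tensorExpand i (exists_truncate_eq (a + d + 1) F).choose))

variable {i}

theorem expandFun_sub_mem (hm : ∀ f ∈ m, X ∣ i f) {M : ℕ} {F : CompletedTensor k m}
    {p : A ⊗[k] A} (hp : truncate M F = Ideal.Quotient.mk _ p) :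
    expandFun i F - tensorExpand i p ∈ lowOrder k M := by
  intro d
  rw [X_pow_dvd_iff]
  intro a ha
  have h1 := (exists_truncate_eq (a + d + 1) F).choose_spec
  have h0 := (truncate_eq_of_le (show a + d + 1 ≤ M by omega) hp).symm.trans h1
  rw [Ideal.Quotient.eq] at h0
  have h2 := tensorExpand_mem_lowOrder hm h0 d
  rw [X_pow_dvd_iff] at h2
  have h3 := h2 a (by omega)
  rw [map_sub, map_sub, map_sub, sub_eq_zero] at h3
  rw [map_sub, map_sub, sub_eq_zero, expandFun, coeff_mk, coeff_mk, h3]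

theorem expandFun_eq (hm : ∀ f ∈ m, X ∣ i f) {F : CompletedTensor k m} {H : k⟦X⟧⟦X⟧}
    (h : ∀ M, ∃ p, truncate M F = Ideal.Quotient.mk _ p ∧ tensorExpand i p - H ∈ lowOrder k M) :
    expandFun i F = H :=
  eq_of_forall_sub_mem_lowOrder fun M => by
    obtain ⟨p, hp, hH⟩ := h M
    simpa using add_mem (expandFun_sub_mem hm hp) hH

/-- The homomorphism from the complete tensor product to `k⟦x⟧⟦y⟧` with `f ⊗ g ↦ f(x) g(y)`. -/
def expand (hm : ∀ f ∈ m, X ∣ i f) : CompletedTensor k m →+* k⟦X⟧⟦X⟧ where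
  toFun := expandFun i
  map_one' := expandFun_eq hm fun M => ⟨1, by simp, by simp⟩
  map_zero' := expandFun_eq hm fun M => ⟨0, by simp, by simp⟩
  map_add' F G := expandFun_eq hm fun M => by
    obtain ⟨p, hp⟩ := exists_truncate_eq M F
    obtain ⟨q, hq⟩ := exists_truncate_eq M G
    refine ⟨p + q, by rw [map_add, hp, hq, map_add], ?_⟩
    have := neg_mem (add_mem (expandFun_sub_mem hm hp) (expandFun_sub_mem hm hq))
    convert this using 1
    rw [map_add]
    ring
  map_mul' F G := expandFun_eq hm fun M => by
    obtain ⟨p, hp⟩ := exists_truncate_eq M F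
    obtain ⟨q, hq⟩ := exists_truncate_eq M G
    refine ⟨p * q, by rw [map_mul, hp, hq, map_mul], ?_⟩
    have := neg_mem (add_mem
      (Ideal.mul_mem_left _ (tensorExpand i p) (expandFun_sub_mem hm hq))
      (Ideal.mul_mem_left _ (expandFun i G) (expandFun_sub_mem hm hp)))
    convert this using 1
    rw [map_mul]
    ring

theorem expand_sub_mem (hm : ∀ f ∈ m, X ∣ i f) {M : ℕ} {F : CompletedTensor k m}
    {p : A ⊗[k] A} (hp : truncate M F = Ideal.Quotient.mk _ p) :
    expand hm F - tensorExpand i p ∈ lowOrder k M :=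
  expandFun_sub_mem hm hp

theorem expand_algebraMap (hm : ∀ f ∈ m, X ∣ i f) (p : A ⊗[k] A) :
    expand hm (algebraMap (A ⊗[k] A) (CompletedTensor k m) p) = tensorExpand i p :=
  expandFun_eq hm fun M => ⟨p, AlgHom.commutes _ _, by simp⟩

theorem diagEq_dvd_C_sub_map (g : k⟦X⟧) : diagEq k ∣ C g - PowerSeries.map C g := by
  refine diagEq_dvd_of_diagEval_eq_zero ?_
  rw [map_sub, diagEval_C, diagEval_map_C, sub_self]

theorem diagEq_pow_dvd_expand (hm : ∀ f ∈ m, X ∣ i f) {n : ℕ} {F : CompletedTensor k m}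
    (hF : F ∈ diagonalIdeal k m ^ n) : diagEq k ^ n ∣ expand hm F := by
  have h1 : diagonalIdeal k m ≤ (Ideal.span {diagEq k}).comap (expand hm) := by
    rw [diagonalIdeal, Ideal.span_le]
    rintro _ ⟨a, rfl⟩
    change expand hm _ ∈ Ideal.span _
    rw [expand_algebraMap, map_sub, tensorExpand_tmul, tensorExpand_tmul,
      Ideal.mem_span_singleton]
    simpa using diagEq_dvd_C_sub_map (i a)
  have h2 := Ideal.le_comap_pow (expand hm) n (Ideal.pow_right_mono h1 n hF)
  rwa [Ideal.mem_comap, Ideal.span_singleton_pow, Ideal.mem_span_singleton] at h2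

end Expansion

/-! ### The conductor and the torsion of the module of principal parts -/

section Transfer

open PowerSeries

variable {k A : Type u} [Field k] [CommRing A] [Algebra k A]

theorem tmul_mem_tensorIdeal_pow_left {m : Ideal A} {M : ℕ} {a : A} (ha : a ∈ m ^ M) (b : A) :
    a ⊗ₜ[k] b ∈ tensorIdeal k m ^ M := by
  have h1 : a ⊗ₜ[k] (1 : A) ∈ tensorIdeal k m ^ M := by
    refine Ideal.pow_right_mono (le_sup_left : _ ≤ tensorIdeal k m) M ?_
    rw [← Ideal.map_pow]
    exact Ideal.mem_map_of_mem (Algebra.TensorProduct.includeLeft : A →ₐ[k] A ⊗[k] A) ha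
  have h2 : a ⊗ₜ[k] b = (a ⊗ₜ[k] (1 : A)) * (1 ⊗ₜ[k] b) := by simp
  rw [h2]
  exact Ideal.mul_mem_right _ _ h1

theorem tmul_mem_tensorIdeal_pow_right {m : Ideal A} {M : ℕ} (a : A) {b : A} (hb : b ∈ m ^ M) :
    a ⊗ₜ[k] b ∈ tensorIdeal k m ^ M := by
  have h1 : (1 : A) ⊗ₜ[k] b ∈ tensorIdeal k m ^ M := by
    refine Ideal.pow_right_mono (le_sup_right : _ ≤ tensorIdeal k m) M ?_
    rw [← Ideal.map_pow]
    exact Ideal.mem_map_of_mem (Algebra.TensorProduct.includeRight : A →ₐ[k] A ⊗[k] A) hb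
  have h2 : a ⊗ₜ[k] b = (a ⊗ₜ[k] (1 : A)) * (1 ⊗ₜ[k] b) := by simp
  rw [h2]
  exact Ideal.mul_mem_left _ _ h1

/-- A conductor of an embedding `i : A → k⟦x⟧`: the multiples of `x ^ c` lie in the image of `A`,
by way of a map `κ`, and `m` is the ideal of elements of positive order. -/
structure Conductor (i : A →ₐ[k] k⟦X⟧) (m : Ideal A) where
  /-- the exponent of the conductor -/
  c : ℕ
  /-- multiplication with `x ^ c` -/
  κ : k⟦X⟧ →ₗ[k] A
  pos : 0 < c
  map_κ : ∀ f, i (κ f) = X ^ c * f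
  injective : Function.Injective i
  mem_iff : ∀ f, f ∈ m ↔ X ∣ i f

namespace Conductor

variable {i : A →ₐ[k] k⟦X⟧} {m : Ideal A} (D : Conductor i m)

theorem κ_mul (r : A) (f : k⟦X⟧) : D.κ (i r * f) = r * D.κ f :=
  D.injective (by rw [D.map_κ, map_mul, D.map_κ, mul_left_comm])

theorem κ_mem {M e : ℕ} (he : D.c * M ≤ e) {f : k⟦X⟧} (hf : X ^ e ∣ f) : D.κ f ∈ m ^ M := by
  obtain ⟨g, rfl⟩ := hf
  have h1 : D.κ 1 ∈ m := by
    rw [D.mem_iff, D.map_κ, mul_one]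
    exact dvd_pow_self X D.pos.ne'
  have h2 : D.κ (X ^ e * g) = D.κ 1 ^ M * D.κ (X ^ (e - D.c * M) * g) := D.injective (by
    rw [map_mul i, map_pow i, D.map_κ, D.map_κ, D.map_κ, mul_one, ← pow_mul]
    nth_rewrite 1 [← Nat.add_sub_cancel' he]
    rw [pow_add]
    ring)
  rw [h2]
  exact Ideal.mul_mem_right _ _ (Ideal.pow_mem_pow h1 M)

/-- The approximations of `transfer`: the partial sums of `∑ x ^ c H_d ⊗ x ^ c x ^ d`, where `H_d` is
the coefficient of `y ^ d` in `H`. -/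
def transferSeq (H : k⟦X⟧⟦X⟧) (M : ℕ) : A ⊗[k] A :=
  ∑ d ∈ Finset.range (D.c * M), D.κ (coeff d H) ⊗ₜ[k] D.κ (X ^ d)

theorem transferSeq_succ_sub (H : k⟦X⟧⟦X⟧) (M : ℕ) :
    D.transferSeq H (M + 1) - D.transferSeq H M ∈ tensorIdeal k m ^ M := by
  rw [transferSeq, transferSeq, ← Finset.sum_sdiff_eq_sub (Finset.range_mono (by gcongr; omega))]
  refine sum_mem fun d hd => ?_
  rw [Finset.mem_sdiff, Finset.mem_range, Finset.mem_range, not_lt] at hd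
  exact tmul_mem_tensorIdeal_pow_right _ (D.κ_mem hd.2 dvd_rfl)

/-- The additive map from `k⟦x⟧⟦y⟧` to the complete tensor product that lifts the multiplication with
`x ^ c y ^ c`. -/
def transfer (H : k⟦X⟧⟦X⟧) : CompletedTensor k m :=
  AdicCompletion.mk _ _ (AdicCompletion.AdicCauchySequence.mk (tensorIdeal k m) (A ⊗[k] A)
    (D.transferSeq H) fun M => by
      rw [SModEq.comm, SModEq.sub_mem, smul_eq_mul, Ideal.mul_top]
      exact D.transferSeq_succ_sub H M)

theorem truncate_transfer (H : k⟦X⟧⟦X⟧) (M : ℕ) :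
    truncate M (D.transfer H) = Ideal.Quotient.mk _ (D.transferSeq H M) :=
  AdicCompletion.evalₐ_mk _ _ _

theorem transfer_eq {H : k⟦X⟧⟦X⟧} {F : CompletedTensor k m}
    (h : ∀ M, truncate M F = Ideal.Quotient.mk _ (D.transferSeq H M)) : D.transfer H = F :=
  AdicCompletion.ext_evalₐ fun M => (D.truncate_transfer H M).trans (h M).symm

theorem transferSeq_add (H G : k⟦X⟧⟦X⟧) (M : ℕ) :
    D.transferSeq (H + G) M = D.transferSeq H M + D.transferSeq G M := by
  simp only [transferSeq, map_add, TensorProduct.add_tmul, Finset.sum_add_distrib]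

theorem transfer_add (H G : k⟦X⟧⟦X⟧) :
    D.transfer (H + G) = D.transfer H + D.transfer G :=
  D.transfer_eq fun M => by
    rw [map_add, truncate_transfer, truncate_transfer, transferSeq_add, map_add]

theorem transfer_C_mul (r : A) (H : k⟦X⟧⟦X⟧) : D.transfer (C (i r) * H) =
    algebraMap (A ⊗[k] A) (CompletedTensor k m) (r ⊗ₜ 1) * D.transfer H :=
  D.transfer_eq fun M => by
    rw [map_mul, truncate_transfer, AlgHom.commutes, Ideal.Quotient.algebraMap_eq, ← map_mul]
    congr 1
    simp only [transferSeq, coeff_C_mul, D.κ_mul, Finset.mul_sum,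
      Algebra.TensorProduct.tmul_mul_tmul, one_mul]

theorem transfer_map_mul (g : A) (H : k⟦X⟧⟦X⟧) : D.transfer (PowerSeries.map C (i g) * H) =
    algebraMap (A ⊗[k] A) (CompletedTensor k m) (1 ⊗ₜ g) * D.transfer H :=
  D.transfer_eq fun M => by
    rw [map_mul, truncate_transfer, AlgHom.commutes, Ideal.Quotient.algebraMap_eq, ← map_mul,
      Ideal.Quotient.eq]
    have h1 : D.transferSeq (PowerSeries.map C (i g) * H) M =
        ∑ b ∈ Finset.range (D.c * M), D.κ (coeff b H) ⊗ₜ[k]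
          D.κ (∑ a ∈ Finset.range (D.c * M - b), C (coeff a (i g)) * X ^ (b + a)) := by
      simp only [map_sum, TensorProduct.tmul_sum]
      rw [← Finset.sum_range_diag_flip (D.c * M) fun b a =>
        D.κ (coeff b H) ⊗ₜ[k] D.κ (C (coeff a (i g)) * X ^ (b + a)), transferSeq]
      refine Finset.sum_congr rfl fun d _ => ?_
      rw [mul_comm, coeff_mul, map_sum, TensorProduct.sum_tmul,
        Finset.Nat.sum_antidiagonal_eq_sum_range_succ fun b a =>
          D.κ (coeff b H * coeff a (PowerSeries.map C (i g))) ⊗ₜ[k] D.κ (X ^ d)]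
      refine Finset.sum_congr rfl fun b hb => ?_
      rw [Finset.mem_range] at hb
      rw [coeff_map, mul_comm, ← smul_eq_C_mul, ← smul_eq_C_mul, map_smul, map_smul,
        TensorProduct.smul_tmul, Nat.add_sub_cancel' (by omega)]
    rw [h1, transferSeq, Finset.mul_sum, ← Finset.sum_sub_distrib]
    refine sum_mem fun b hb => ?_
    rw [Finset.mem_range] at hb
    rw [Algebra.TensorProduct.tmul_mul_tmul, one_mul, ← D.κ_mul, ← TensorProduct.tmul_sub,
      ← map_sub]
    refine tmul_mem_tensorIdeal_pow_right _ (D.κ_mem le_rfl ?_)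
    rw [X_pow_dvd_iff]
    intro a ha
    rw [map_sub, map_sum, sub_eq_zero, coeff_mul_X_pow']
    simp only [coeff_C_mul, coeff_X_pow, mul_ite, mul_one, mul_zero]
    split_ifs with hab
    · rw [Finset.sum_eq_single (a - b), if_pos (by omega)]
      · intro e _ he
        rw [if_neg (by omega)]
      · intro h
        rw [Finset.mem_range] at h
        omega
    · refine (Finset.sum_eq_zero fun e _ => ?_).symm
      rw [if_neg (by omega)]

theorem transfer_tensorExpand_mul (p : A ⊗[k] A) (H : k⟦X⟧⟦X⟧) :
    D.transfer (tensorExpand i p * H) =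
      algebraMap (A ⊗[k] A) (CompletedTensor k m) p * D.transfer H := by
  induction p using TensorProduct.induction_on with
  | zero => 
    have := D.transfer_add 0 0
    simpa using this
  | tmul f g =>
    rw [tensorExpand_tmul, mul_assoc, transfer_C_mul, transfer_map_mul, ← mul_assoc, ← map_mul,
      Algebra.TensorProduct.tmul_mul_tmul, mul_one, one_mul]
  | add p q hp hq => rw [map_add, add_mul, transfer_add, hp, hq, map_add, add_mul]

theorem transferSeq_mem {M : ℕ} {H : k⟦X⟧⟦X⟧} (hH : H ∈ lowOrder k (D.c * M + D.c * M)) :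
    D.transferSeq H M ∈ tensorIdeal k m ^ M := by
  refine sum_mem fun d hd => ?_
  rw [Finset.mem_range] at hd
  exact tmul_mem_tensorIdeal_pow_left (D.κ_mem (by omega) (hH d)) _

theorem dvd_of_mem (D : Conductor i m) : ∀ f ∈ m, X ∣ i f := fun f hf => (D.mem_iff f).1 hf

theorem transfer_expand_mul (F : CompletedTensor k m) (H : k⟦X⟧⟦X⟧) :
    D.transfer (expand D.dvd_of_mem F * H) = F * D.transfer H := by
  refine D.transfer_eq fun M => ?_
  have hle : M ≤ D.c * M + D.c * M := by nlinarith [D.pos]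
  obtain ⟨p, hp⟩ := exists_truncate_eq (D.c * M + D.c * M) F
  have h1 := D.transferSeq_mem (Ideal.mul_mem_right H _ (expand_sub_mem D.dvd_of_mem hp))
  have h2 := congrArg (truncate M) (D.transfer_tensorExpand_mul p H)
  rw [truncate_transfer, map_mul, AlgHom.commutes, Ideal.Quotient.algebraMap_eq] at h2
  rw [map_mul, truncate_eq_of_le hle hp, ← h2, eq_comm, Ideal.Quotient.eq]
  convert h1 using 1
  rw [eq_comm, eq_sub_iff_add_eq, ← transferSeq_add, sub_mul, sub_add_cancel]

theorem transfer_one : D.transfer 1 =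
    algebraMap (A ⊗[k] A) (CompletedTensor k m) (D.κ 1 ⊗ₜ D.κ 1) := by
  refine D.transfer_eq fun M => ?_
  rw [AlgHom.commutes, Ideal.Quotient.algebraMap_eq]
  rcases Nat.eq_zero_or_pos M with rfl | hM
  · rw [Ideal.Quotient.eq, pow_zero, Ideal.one_eq_top]
    trivial
  · congr 1
    rw [transferSeq, Finset.sum_eq_single 0]
    · simp
    · intro d _ hd
      rw [coeff_one, if_neg hd, map_zero, TensorProduct.zero_tmul]
    · intro h
      exact absurd (Finset.mem_range.2 (Nat.mul_pos D.pos hM)) h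

/-- The element `a ⊗ 1 - 1 ⊗ a` of the diagonal ideal. -/
def diff (m : Ideal A) (a : A) : CompletedTensor k m :=
  algebraMap (A ⊗[k] A) (CompletedTensor k m) (a ⊗ₜ[k] 1 - 1 ⊗ₜ[k] a)

theorem diff_mem (m : Ideal A) (a : A) : diff (k := k) m a ∈ diagonalIdeal k m :=
  Ideal.subset_span ⟨a, rfl⟩

theorem expand_diff (a : A) : expand D.dvd_of_mem (diff m a) =
    C (i a) - PowerSeries.map C (i a) := by
  rw [diff, expand_algebraMap, map_sub, tensorExpand_tmul, tensorExpand_tmul]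
  simp

/-- The equation of the diagonal is, up to a power of `x`, a combination of the expansions of
elements of the diagonal ideal, because `x ^ c` and `x ^ (c + 1)` both lie in `A`. -/
theorem C_X_pow_mul_diagEq : C (X ^ D.c) * diagEq k =
    X * expand D.dvd_of_mem (diff m (D.κ 1)) - expand D.dvd_of_mem (diff m (D.κ X)) := by
  rw [D.expand_diff, D.expand_diff, D.map_κ, D.map_κ, diagEq]
  simp only [map_mul, map_pow, map_X, mul_one]
  ring

theorem transfer_mem (n : ℕ) (G : k⟦X⟧⟦X⟧) :
    D.transfer ((C (X ^ D.c) * diagEq k) ^ n * G) ∈ diagonalIdeal k m ^ n := by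
  induction n generalizing G with
  | zero => simp
  | succ n ih =>
    have h1 : (C (X ^ D.c) * diagEq k) ^ (n + 1) * G =
        expand D.dvd_of_mem (diff m (D.κ 1)) * ((C (X ^ D.c) * diagEq k) ^ n * (X * G)) +
        expand D.dvd_of_mem (diff m (D.κ X)) * ((C (X ^ D.c) * diagEq k) ^ n * -G) := by
      rw [pow_succ]
      nth_rewrite 2 [D.C_X_pow_mul_diagEq]
      ring
    rw [h1, transfer_add, transfer_expand_mul, transfer_expand_mul, pow_succ']
    exact add_mem (Ideal.mul_mem_mul (diff_mem m _) (ih _)) (Ideal.mul_mem_mul (diff_mem m _) (ih _))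

/-- If the expansion of `F` is divisible by `(y - x) ^ (n + 1)`, then `F` is a torsion element modulo
the power of the diagonal ideal. -/
theorem exists_smul_mem {n : ℕ} {F : CompletedTensor k m}
    (hF : diagEq k ^ (n + 1) ∣ expand D.dvd_of_mem F) :
    ∃ a : A, a ≠ 0 ∧ a • F ∈ diagonalIdeal k m ^ (n + 1) := by
  obtain ⟨G, hG⟩ := hF
  let u : CompletedTensor k m := algebraMap (A ⊗[k] A) _ (D.κ 1 ⊗ₜ 1)
  let v : CompletedTensor k m := algebraMap (A ⊗[k] A) _ (1 ⊗ₜ D.κ 1)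
  have huv : u - v ∈ diagonalIdeal k m := by
    rw [← map_sub]; exact diff_mem m (D.κ 1)
  have hu : expand D.dvd_of_mem u = C (X ^ D.c) := by
    rw [expand_algebraMap, tensorExpand_tmul, D.map_κ]
    simp
  have h1 : u ^ (n + 1) * F * (u * v) ∈ diagonalIdeal k m ^ (n + 1) := by
    have h2 := D.transfer_mem (n + 1) G
    rw [mul_pow, mul_assoc, ← hG, ← hu, ← map_pow, ← map_mul, ← mul_one (expand _ _),
      transfer_expand_mul, transfer_one] at h2
    convert h2 using 2
    rw [← map_mul, Algebra.TensorProduct.tmul_mul_tmul, mul_one, one_mul]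
  -- Modulo the diagonal ideal `v` equals `u`, so that the factor `v` can be traded for powers of `u`.
  obtain ⟨w, hw⟩ := sub_dvd_pow_sub_pow u (u - v) (n + 1)
  rw [sub_sub_cancel] at hw
  have h3 : u ^ (n + 1 + (n + 1) + 1) * F ∈ diagonalIdeal k m ^ (n + 1) := by
    have : u ^ (n + 1 + (n + 1) + 1) * F =
        u ^ (n + 1) * F * (u * v) * w + u ^ (n + 2) * F * (u - v) ^ (n + 1) := by
      linear_combination (u ^ (n + 2) * F) * hw
    rw [this]
    exact add_mem (Ideal.mul_mem_right _ _ h1) (Ideal.mul_mem_left _ _ (Ideal.pow_mem_pow huv _))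
  refine ⟨D.κ 1 ^ (n + 1 + (n + 1) + 1), ?_, ?_⟩
  · intro h
    have := congrArg i h
    rw [map_pow, D.map_κ, map_zero, mul_one] at this
    exact pow_ne_zero _ (pow_ne_zero _ X_ne_zero) this
  · convert h3 using 1
    rw [Algebra.smul_def, map_pow]
    rfl

end Conductor

end Transfer

/-! ### Jets of power series and Vandermonde matrices -/

section Lead

open PowerSeries Matrix

variable {k : Type u} [Field k]

/-- The `j`-th iterated Euler derivative of `g`, divided by `x ^ s`; here `g` should be divisible by
`x ^ s`. -/
def lead (s : ℕ) (g : k⟦X⟧) (j : ℕ) : k⟦X⟧ :=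
  PowerSeries.mk fun d => ((d + s : ℕ) : k) ^ j * coeff (d + s) g

theorem X_pow_mul_lead {s : ℕ} {g : k⟦X⟧} (h : X ^ s ∣ g) (j : ℕ) :
    X ^ s * lead s g j = (euler k)^[j] g := by
  ext d
  rw [coeff_X_pow_mul', coeff_euler_pow]
  split_ifs with hd
  · rw [lead, coeff_mk, Nat.sub_add_cancel hd]
  · rw [X_pow_dvd_iff.1 h d (not_le.1 hd), mul_zero]

theorem constantCoeff_lead (s : ℕ) (g : k⟦X⟧) (j : ℕ) :
    constantCoeff (lead s g j) = (s : k) ^ j * coeff s g := by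
  rw [← coeff_zero_eq_constantCoeff_apply, lead, coeff_mk, zero_add]

/-- The matrix of the iterated Euler derivatives of the power series `g l`, its `l`-th row divided by
`x ^ σ l`. -/
def leadMatrix {N : ℕ} (σ : Fin N → ℕ) (g : Fin N → k⟦X⟧) : Matrix (Fin N) (Fin N) k⟦X⟧ :=
  Matrix.of fun l j => lead (σ l) (g l) j

variable {N : ℕ} {σ : Fin N → ℕ} {g : Fin N → k⟦X⟧}

theorem map_constantCoeff_leadMatrix (hg : ∀ l, coeff (σ l) (g l) = 1) :
    (constantCoeff (R := k)).mapMatrix (leadMatrix σ g) = vandermonde fun l => (σ l : k) := by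
  ext l j
  simp [leadMatrix, constantCoeff_lead, hg, vandermonde_apply]

variable [CharZero k]

/-- In characteristic zero, power series of different orders have independent iterated Euler
derivatives, even after division by the powers of `x` and reduction modulo `x`: the resulting matrix
is a Vandermonde matrix. -/
theorem isUnit_det_leadMatrix (hσ : Function.Injective σ) (hg : ∀ l, coeff (σ l) (g l) = 1) :
    IsUnit (leadMatrix σ g).det := by
  rw [isUnit_iff_constantCoeff, RingHom.map_det, map_constantCoeff_leadMatrix hg, isUnit_iff_ne_zero,
    det_vandermonde_ne_zero_iff]
  exact fun a b h => hσ (Nat.cast_injective h)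

/-- The coordinates of the jet of a power series of a new order `s` with respect to the jets of the
`g l` are units up to the expected power of `x`. -/
theorem isUnit_vecMul_inv_leadMatrix (hσ : Function.Injective σ)
    (hg : ∀ l, coeff (σ l) (g l) = 1) {s : ℕ} {h : k⟦X⟧} (hh : coeff s h = 1) {l : Fin N}
    (hs : ∀ l' ≠ l, s ≠ σ l') :
    IsUnit (vecMul (fun j : Fin N => lead s h j) (leadMatrix σ g)⁻¹ l) := by
  set z := vecMul (fun j : Fin N => lead s h j) (leadMatrix σ g)⁻¹ with hz
  have h1 : vecMul z (leadMatrix σ g) = fun j : Fin N => lead s h j := by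
    rw [hz, vecMul_vecMul, nonsing_inv_mul _ (isUnit_det_leadMatrix hσ hg), vecMul_one]
  have h2 (j : Fin N) : ∑ l', constantCoeff (z l') * (σ l' : k) ^ (j : ℕ) = (s : k) ^ (j : ℕ) := by
    have := congrArg constantCoeff (congrFun h1 j)
    simpa [vecMul, dotProduct, leadMatrix, constantCoeff_lead, hg, hh] using this
  have h3 (p : Polynomial k) (hp : p.natDegree < N) :
      ∑ l', constantCoeff (z l') * p.eval (σ l' : k) = p.eval (s : k) := by
    simp only [Polynomial.eval_eq_sum_range' hp, Finset.sum_range, ← h2, Finset.mul_sum]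
    rw [Finset.sum_comm]
    exact Finset.sum_congr rfl fun a _ => Finset.sum_congr rfl fun b _ => by ring
  -- Test the relation on the polynomial with the zeros `σ l'`, `l' ≠ l`.
  let p : Polynomial k := ∏ l' ∈ Finset.univ.erase l, (Polynomial.X - Polynomial.C (σ l' : k))
  have hp : p.natDegree < N := by
    rw [Polynomial.natDegree_prod_of_monic _ _ fun _ _ => Polynomial.monic_X_sub_C _]
    simp only [Polynomial.natDegree_X_sub_C, Finset.sum_const, smul_eq_mul, mul_one,
      Finset.card_erase_of_mem (Finset.mem_univ l), Finset.card_univ, Fintype.card_fin]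
    have := l.pos
    omega
  have hps : p.eval (s : k) ≠ 0 := by
    rw [Polynomial.eval_prod, Finset.prod_ne_zero_iff]
    intro l' hl'
    rw [Polynomial.eval_sub, Polynomial.eval_X, Polynomial.eval_C, sub_ne_zero]
    exact fun h => hs l' (Finset.ne_of_mem_erase hl') (Nat.cast_injective h)
  have h4 := h3 p hp
  rw [Finset.sum_eq_single l] at h4
  · rw [isUnit_iff_constantCoeff, isUnit_iff_ne_zero]
    intro h5
    rw [h5, zero_mul] at h4
    exact hps h4.symm
  · intro l' _ hl'
    rw [Polynomial.eval_prod, Finset.prod_eq_zero (Finset.mem_erase.2 ⟨hl', Finset.mem_univ _⟩),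
      mul_zero]
    simp
  · simp

end Lead

/-! ### The jets of the principal parts -/

section Jets

open PowerSeries Matrix

variable {k A : Type u} [Field k] [CommRing A] [Algebra k A] {i : A →ₐ[k] k⟦X⟧} {m : Ideal A}

theorem expand_smul (hm : ∀ f ∈ m, X ∣ i f) (a : A) (F : CompletedTensor k m) :
    expand hm (a • F) = C (i a) * expand hm F := by
  have : a • F = algebraMap (A ⊗[k] A) (CompletedTensor k m) (a ⊗ₜ 1) * F := by
    rw [Algebra.smul_def]; rfl
  rw [this, map_mul, expand_algebraMap, tensorExpand_tmul, map_one, map_one, mul_one]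

/-- The class in the module of principal parts of an element of the completed tensor product. -/
abbrev toPrincipalParts (k : Type u) {A : Type u} [Field k] [CommRing A] [Algebra k A] (m : Ideal A)
    (n : ℕ) : CompletedTensor k m →+* PrincipalParts k m n :=
  Ideal.Quotient.mk (diagonalIdeal k m ^ (n + 1))

/-- The class of `1 ⊗ g` in the module of principal parts. -/
def differential (k : Type u) {A : Type u} [Field k] [CommRing A] [Algebra k A] (m : Ideal A)
    (n : ℕ) (g : A) : PrincipalParts k m n :=
  toPrincipalParts k m n (algebraMap (A ⊗[k] A) _ (1 ⊗ₜ g))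

/-- The embedding up to torsion of the module of principal parts into `K ^ (n + 1)`, which sends
`f ⊗ g` to `f` times the iterated Euler derivatives of `g`. -/
def principalJet (hm : ∀ f ∈ m, X ∣ i f) [Algebra A k⸨X⸩]
    (hA : ∀ a, algebraMap A k⸨X⸩ a = algebraMap k⟦X⟧ k⸨X⸩ (i a)) (n : ℕ) :
    PrincipalParts k m n →ₗ[A] (Fin (n + 1) → k⸨X⸩) :=
  Submodule.liftQ ((diagonalIdeal k m ^ (n + 1)).restrictScalars A)
    { toFun := fun F j => algebraMap k⟦X⟧ k⸨X⸩ (diagJet k j (expand hm F))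
      map_add' := fun F G => by ext1 j; simp
      map_smul' := fun a F => by
        ext1 j
        rw [expand_smul, diagJet_C_mul, map_mul, ← hA, Pi.smul_apply, Algebra.smul_def]
        rfl }
    (fun F hF => by
      ext1 j
      have h := diagJet_eq_zero_of_dvd (diagEq_pow_dvd_expand hm hF) (Nat.lt_succ_iff.1 j.2)
      change algebraMap k⟦X⟧ k⸨X⸩ (diagJet k j (expand hm F)) = 0
      rw [h, map_zero]) ∘ₗ
  (Submodule.Quotient.restrictScalarsEquiv A (diagonalIdeal k m ^ (n + 1))).symm.toLinearMap

variable (hm : ∀ f ∈ m, X ∣ i f) [Algebra A k⸨X⸩]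
    (hA : ∀ a, algebraMap A k⸨X⸩ a = algebraMap k⟦X⟧ k⸨X⸩ (i a)) (n : ℕ)

theorem principalJet_apply (F : CompletedTensor k m) (j : Fin (n + 1)) :
    principalJet hm hA n (toPrincipalParts k m n F) j =
      algebraMap k⟦X⟧ k⸨X⸩ (diagJet k j (expand hm F)) := rfl

theorem principalJet_differential (g : A) (j : Fin (n + 1)) :
    principalJet hm hA n (differential k m n g) j =
      algebraMap k⟦X⟧ k⸨X⸩ ((euler k)^[j] (i g)) := by
  rw [differential, principalJet_apply, expand_algebraMap, tensorExpand_tmul, diagJet_tensor,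
    map_one, one_mul]

theorem exists_smul_eq_zero_of_principalJet_eq_zero [CharZero k] (D : Conductor i m)
    (x : PrincipalParts k m n) (hx : principalJet D.dvd_of_mem hA n x = 0) :
    ∃ a : A, a ≠ 0 ∧ a • x = 0 := by
  obtain ⟨F, rfl⟩ := Ideal.Quotient.mk_surjective x
  have h1 : diagEq k ^ (n + 1) ∣ expand D.dvd_of_mem F := by
    refine diagEq_pow_dvd fun j hj => ?_
    have := congrFun hx ⟨j, Nat.lt_succ_iff.2 hj⟩
    rw [principalJet_apply, Pi.zero_apply] at this
    exact (map_eq_zero_iff _ (IsFractionRing.injective k⟦X⟧ k⸨X⸩)).1 this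
  obtain ⟨a, ha, h2⟩ := D.exists_smul_mem h1
  exact ⟨a, ha, Ideal.Quotient.eq_zero_iff_mem.2 h2⟩

/-- Up to high powers of `x`, an element of the completed tensor product is a sum of products. -/
theorem exists_principalJet_sub (M : ℕ) (F : CompletedTensor k m) :
    ∃ p : A ⊗[k] A, ∃ v : Fin (n + 1) → k⟦X⟧, ∀ j, principalJet hm hA n (toPrincipalParts k m n F) j =
      principalJet hm hA n (toPrincipalParts k m n (algebraMap (A ⊗[k] A) _ p)) j +
        algebraMap k⟦X⟧ k⸨X⸩ (X ^ M * v j) := by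
  obtain ⟨p, hp⟩ := exists_truncate_eq M F
  have h1 (j : Fin (n + 1)) := X_pow_dvd_diagJet (expand_sub_mem hm hp) j
  choose v hv using h1
  refine ⟨p, v, fun j => ?_⟩
  rw [principalJet_apply, principalJet_apply, expand_algebraMap, ← map_add, ← hv, map_sub,
    add_sub_cancel]

end Jets

/-! ### The chart of a system adapted to the orders -/

section Orders

open PowerSeries

variable {k A : Type u} [Field k] [CommRing A] [Algebra k A]

/-- The set of orders of the nonzero elements of `A`. -/
def orders (i : A →ₐ[k] k⟦X⟧) : Set ℕ := {s | ∃ a : A, order (i a) = s}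

/-- The `l`-th smallest order of an element of `A`, starting with `0` for `l = 0`. -/
def orderNth (i : A →ₐ[k] k⟦X⟧) (l : ℕ) : ℕ := Nat.nth (· ∈ orders i) l

variable {i : A →ₐ[k] k⟦X⟧} {m : Ideal A} (D : Conductor i m)

namespace Conductor

theorem infinite_orders (D : Conductor i m) : (orders i).Infinite := by
  refine Set.infinite_of_injective_forall_mem (f := fun N => D.c + N) (add_right_injective _)
    fun N => ⟨D.κ (X ^ N), ?_⟩
  rw [D.map_κ, ← pow_add, order_X_pow]

theorem orderNth_strictMono (D : Conductor i m) : StrictMono (orderNth i) :=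
  Nat.nth_strictMono D.infinite_orders

theorem exists_order_eq_orderNth (D : Conductor i m) (l : ℕ) :
    ∃ a : A, X ^ orderNth i l ∣ i a ∧ coeff (orderNth i l) (i a) = 1 := by
  obtain ⟨a, ha⟩ := Nat.nth_mem_of_infinite D.infinite_orders l
  change order (i a) = orderNth i l at ha
  have h1 : coeff (orderNth i l) (i a) ≠ 0 := by
    have h := coeff_order (φ := i a) (by rintro h; simp [h] at ha)
    rwa [ha] at h
  refine ⟨(coeff (orderNth i l) (i a))⁻¹ • a, ?_, ?_⟩
  · rw [map_smul, smul_eq_C_mul]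
    exact Dvd.dvd.mul_left (X_pow_dvd_iff.2 fun d hd => coeff_of_lt_order _ (by rw [ha]; exact_mod_cast hd)) _
  · rw [map_smul, map_smul, smul_eq_mul, inv_mul_cancel₀ h1]

/-- An element of `A` of order `orderNth i l` with leading coefficient `1`. -/
def adapted (D : Conductor i m) (l : ℕ) : A := (D.exists_order_eq_orderNth l).choose

theorem dvd_adapted (l : ℕ) : X ^ orderNth i l ∣ i (D.adapted l) :=
  (D.exists_order_eq_orderNth l).choose_spec.1

theorem coeff_adapted (l : ℕ) : coeff (orderNth i l) (i (D.adapted l)) = 1 :=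
  (D.exists_order_eq_orderNth l).choose_spec.2

end Conductor

theorem orderNth_succ_dvd {l : ℕ} {a : A} (h : X ^ (orderNth i l + 1) ∣ i a) :
    X ^ orderNth i (l + 1) ∣ i a := by
  by_cases h0 : i a = 0
  · rw [h0]; exact dvd_zero _
  have hs := (coe_toNat_order h0).symm
  have h1 : orderNth i l < (i a).order.toNat := by
    by_contra! h1
    exact coeff_order h0 (X_pow_dvd_iff.1 h _ (Nat.lt_succ_iff.2 h1))
  have h2 : orderNth i (l + 1) ≤ (i a).order.toNat := by
    by_contra! h3
    exact h1.not_ge (Nat.le_nth_of_lt_nth_succ h3 ⟨a, hs⟩)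
  exact (pow_dvd_pow X h2).trans X_pow_order_dvd

end Orders

section Frame

open PowerSeries Matrix

variable {k A : Type u} [Field k] [CommRing A] [Algebra k A] {i : A →ₐ[k] k⟦X⟧} {m : Ideal A}

theorem differential_sub (n : ℕ) (f g : A) :
    differential k m n (f - g) = differential k m n f - differential k m n g := by
  rw [differential, TensorProduct.tmul_sub, map_sub, map_sub]; rfl

theorem smul_differential (n : ℕ) (f g : A) : f • differential k m n g =
    toPrincipalParts k m n (algebraMap (A ⊗[k] A) _ (f ⊗ₜ g)) := by
  have : f ⊗ₜ[k] g = (f ⊗ₜ 1) * (1 ⊗ₜ g) := by simp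
  rw [this, map_mul]
  change toPrincipalParts k m n (f • algebraMap (A ⊗[k] A) (CompletedTensor k m) (1 ⊗ₜ g)) = _
  rw [Algebra.smul_def]
  rfl

theorem differential_smul (n : ℕ) (c : k) (g : A) :
    differential k m n (c • g) = algebraMap k A c • differential k m n g := by
  rw [smul_differential, differential, TensorProduct.tmul_smul, TensorProduct.smul_tmul',
    Algebra.algebraMap_eq_smul_one (A := A) c]

namespace Conductor

/-- The classes of `1 ⊗ g` in the module of principal parts, for `n + 1` elements `g` with the
smallest possible orders. -/
def adaptedFrame (D : Conductor i m) (n : ℕ) (l : Fin (n + 1)) : PrincipalParts k m n :=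
  differential k m n (D.adapted l)

/-- The matrix of the iterated Euler derivatives of the adapted system, its rows divided by the
powers of `x`. -/
abbrev adaptedMatrix (D : Conductor i m) (n : ℕ) : Matrix (Fin (n + 1)) (Fin (n + 1)) k⟦X⟧ :=
  leadMatrix (fun l => orderNth i l) fun l => i (D.adapted l)

theorem orderNth_le_succ (D : Conductor i m) {n : ℕ} (l : Fin (n + 1)) :
    orderNth i l ≤ orderNth i (n + 1) :=
  D.orderNth_strictMono.monotone (by omega)

theorem isUnit_det_adaptedMatrix [CharZero k] (D : Conductor i m) (n : ℕ) :
    IsUnit (D.adaptedMatrix n).det :=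
  isUnit_det_leadMatrix (fun _ _ h => Fin.ext (D.orderNth_strictMono.injective h))
    fun l => D.coeff_adapted l

/-- The first element of the adapted system that does not belong to the frame has a coordinate of
order `orderNth i (n + 1) - orderNth i n`. -/
theorem isUnit_vecMul_last [CharZero k] (D : Conductor i m) (n : ℕ) : IsUnit (vecMul
    (fun j : Fin (n + 1) => lead (orderNth i (n + 1)) (i (D.adapted (n + 1))) j)
      (D.adaptedMatrix n)⁻¹ (Fin.last n)) :=
  isUnit_vecMul_inv_leadMatrix (fun _ _ h => Fin.ext (D.orderNth_strictMono.injective h))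
    (fun l => D.coeff_adapted l) (D.coeff_adapted (n + 1)) fun l _ =>
      (D.orderNth_strictMono l.2).ne'

variable [Algebra A k⸨X⸩] (D : Conductor i m)
  (hA : ∀ a, algebraMap A k⸨X⸩ a = algebraMap k⟦X⟧ k⸨X⸩ (i a)) (n : ℕ)

theorem frameMatrix_adaptedFrame :
    frameMatrix (principalJet D.dvd_of_mem hA n) (D.adaptedFrame n) =
      diagonal (fun l : Fin (n + 1) => algebraMap k⟦X⟧ k⸨X⸩ (X ^ orderNth i l)) *
        (algebraMap k⟦X⟧ k⸨X⸩).mapMatrix (D.adaptedMatrix n) := by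
  refine Matrix.ext fun l j => ?_
  rw [diagonal_mul, frameMatrix, of_apply, adaptedFrame, principalJet_differential,
    RingHom.mapMatrix_apply, map_apply, ← map_mul]
  rw [← X_pow_mul_lead (D.dvd_adapted l)]
  rfl

variable [CharZero k]

theorem isUnit_det_adaptedFrame :
    IsUnit (frameMatrix (principalJet D.dvd_of_mem hA n) (D.adaptedFrame n)).det := by
  rw [frameMatrix_adaptedFrame, det_mul, det_diagonal, ← RingHom.map_det]
  refine IsUnit.mul ?_ ((D.isUnit_det_adaptedMatrix n).map _)
  rw [isUnit_iff_ne_zero, Finset.prod_ne_zero_iff]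
  intro l _
  rw [map_ne_zero_iff _ (IsFractionRing.injective k⟦X⟧ k⸨X⸩)]
  exact pow_ne_zero _ X_ne_zero

theorem frameCoord_adaptedFrame {s : ℕ} (hs : ∀ l : Fin (n + 1), orderNth i l ≤ s)
    {x : PrincipalParts k m n} {v : Fin (n + 1) → k⟦X⟧}
    (hx : ∀ j, principalJet D.dvd_of_mem hA n x j = algebraMap k⟦X⟧ k⸨X⸩ (X ^ s * v j))
    (l : Fin (n + 1)) :
    frameCoord (principalJet D.dvd_of_mem hA n) (D.adaptedFrame n) x l =
      algebraMap k⟦X⟧ k⸨X⸩ (X ^ (s - orderNth i l) * vecMul v (D.adaptedMatrix n)⁻¹ l) := by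
  set z := vecMul v (D.adaptedMatrix n)⁻¹ with hz
  have hzv : vecMul z (D.adaptedMatrix n) = v := by
    rw [hz, vecMul_vecMul, nonsing_inv_mul _ (D.isUnit_det_adaptedMatrix n), vecMul_one]
  let y : Fin (n + 1) → k⸨X⸩ := fun l =>
    algebraMap k⟦X⟧ k⸨X⸩ (X ^ (s - orderNth i l) * z l)
  have h1 : vecMul y (frameMatrix (principalJet D.dvd_of_mem hA n) (D.adaptedFrame n)) =
      principalJet D.dvd_of_mem hA n x := by
    ext1 j
    rw [hx j, ← hzv, D.frameMatrix_adaptedFrame]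
    simp only [vecMul, dotProduct, diagonal_mul, RingHom.mapMatrix_apply, map_apply, y, ← map_mul,
      ← map_sum, Finset.mul_sum]
    congr 1
    refine Finset.sum_congr rfl fun l _ => ?_
    rw [← Nat.sub_add_cancel (hs l), pow_add, Nat.add_sub_cancel]
    ring
  rw [frameCoord_apply, ← h1, vecMul_vecMul,
    mul_nonsing_inv _ (D.isUnit_det_adaptedFrame hA n), vecMul_one]

theorem frameCoord_differential {g : A} (hg : X ^ orderNth i (n + 1) ∣ i g) (l : Fin (n + 1)) :
    frameCoord (principalJet D.dvd_of_mem hA n) (D.adaptedFrame n) (differential k m n g) l =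
      algebraMap k⟦X⟧ k⸨X⸩ (X ^ (orderNth i (n + 1) - orderNth i l) *
        vecMul (fun j : Fin (n + 1) => lead (orderNth i (n + 1)) (i g) j)
          (D.adaptedMatrix n)⁻¹ l) := by
  refine D.frameCoord_adaptedFrame hA n D.orderNth_le_succ (fun j => ?_) l
  rw [principalJet_differential, X_pow_mul_lead hg]

/-- The coordinates with respect to the adapted frame lie in every ring that contains `A` and the
multiples of the powers of `x` whose exponents are the gaps to the next order. -/
theorem frameCoord_mem {T : Subring k⟦X⟧} (hT : ∀ a, i a ∈ T)
    (hX : ∀ (l : Fin (n + 1)) (f : k⟦X⟧), X ^ (orderNth i (n + 1) - orderNth i l) * f ∈ T)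
    (x : PrincipalParts k m n) (l : Fin (n + 1)) :
    frameCoord (principalJet D.dvd_of_mem hA n) (D.adaptedFrame n) x l ∈
      T.map (algebraMap k⟦X⟧ k⸨X⸩) := by
  set Φ := principalJet D.dvd_of_mem hA n
  have hAT (a : A) : algebraMap A k⸨X⸩ a ∈ T.map (algebraMap k⟦X⟧ k⸨X⸩) := by
    rw [hA]; exact Subring.mem_map.2 ⟨_, hT a, rfl⟩
  -- Subtracting multiples of the adapted system raises the order of `g` to `orderNth i (n + 1)`.
  have h1 (N : ℕ) (hN : N ≤ n + 1) : ∀ g : A, X ^ orderNth i (n + 1 - N) ∣ i g →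
      frameCoord Φ (D.adaptedFrame n) (differential k m n g) l ∈
        T.map (algebraMap k⟦X⟧ k⸨X⸩) := by
    induction N with
    | zero =>
      intro g hg
      rw [D.frameCoord_differential hA n hg]
      exact Subring.mem_map.2 ⟨_, hX l _, rfl⟩
    | succ N ih =>
      intro g hg
      set L := n + 1 - (N + 1) with hL
      set r := coeff (orderNth i L) (i g) with hr
      have h2 : X ^ orderNth i (n + 1 - N) ∣ i (g - r • D.adapted L) := by
        rw [show n + 1 - N = L + 1 by omega]
        refine orderNth_succ_dvd (X_pow_dvd_iff.2 fun d hd => ?_)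
        rw [map_sub, map_smul, map_sub, map_smul, smul_eq_mul]
        rcases Nat.lt_succ_iff_lt_or_eq.1 hd with hd | rfl
        · rw [X_pow_dvd_iff.1 hg d hd, X_pow_dvd_iff.1 (D.dvd_adapted L) d hd, mul_zero, sub_zero]
        · rw [D.coeff_adapted, mul_one, hr, sub_self]
      have h3 := ih (by omega) _ h2
      have h4 : frameCoord Φ (D.adaptedFrame n) (differential k m n (r • D.adapted L)) l ∈
          T.map (algebraMap k⟦X⟧ k⸨X⸩) := by
        have h5 : D.adaptedFrame n ⟨L, by omega⟩ = differential k m n (D.adapted L) := rfl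
        rw [differential_smul, map_smul, ← h5, frameCoord_self (D.isUnit_det_adaptedFrame hA n),
          Pi.smul_apply, Algebra.smul_def]
        refine mul_mem (hAT _) ?_
        rw [Pi.single_apply]
        split_ifs
        · exact one_mem _
        · exact zero_mem _
      rw [differential_sub, map_sub, Pi.sub_apply] at h3
      simpa using add_mem h3 h4
  have h2 (p : A ⊗[k] A) : frameCoord Φ (D.adaptedFrame n)
      (toPrincipalParts k m n (algebraMap (A ⊗[k] A) _ p)) l ∈ T.map (algebraMap k⟦X⟧ k⸨X⸩) := by
    induction p using TensorProduct.induction_on with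
    | zero => rw [map_zero, map_zero, map_zero]; exact zero_mem _
    | tmul f g =>
      rw [← smul_differential, map_smul, Pi.smul_apply, Algebra.smul_def]
      refine mul_mem (hAT f) (h1 (n + 1) le_rfl g ?_)
      have : orderNth i (n + 1 - (n + 1)) = 0 := by
        rw [Nat.sub_self, orderNth, Nat.nth_zero_of_zero]
        exact ⟨1, by simp⟩
      rw [this, pow_zero]
      exact one_dvd _
    | add p q hp hq =>
      rw [map_add, map_add, map_add, Pi.add_apply]
      exact add_mem hp hq
  obtain ⟨F, rfl⟩ := Ideal.Quotient.mk_surjective x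
  obtain ⟨p, v, hv⟩ := exists_principalJet_sub D.dvd_of_mem hA n (orderNth i (n + 1)) F
  have h3 := D.frameCoord_adaptedFrame hA n D.orderNth_le_succ
    (x := toPrincipalParts k m n F - toPrincipalParts k m n (algebraMap (A ⊗[k] A) _ p)) (v := v)
    (fun j => by rw [map_sub, Pi.sub_apply, hv, add_sub_cancel_left]) l
  rw [map_sub, Pi.sub_apply, sub_eq_iff_eq_add] at h3
  rw [h3]
  exact add_mem (Subring.mem_map.2 ⟨_, hX l _, rfl⟩) (h2 p)

end Conductor

/-- A linear map to `K ^ r` for which some tuple maps to a basis has a spanning image. -/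
theorem span_range_eq_top_of_isUnit_det {R M K : Type u} [CommRing R] [AddCommGroup M] [Module R M]
    [Field K] [Algebra R K] {r : ℕ} {Φ : M →ₗ[R] (Fin r → K)} {b : Fin r → M}
    (hb : IsUnit (frameMatrix Φ b).det) : Submodule.span K (Set.range Φ) = ⊤ := by
  rw [eq_top_iff]
  intro v _
  have h1 : v = vecMul (vecMul v (frameMatrix Φ b)⁻¹) (frameMatrix Φ b) := by
    rw [vecMul_vecMul, nonsing_inv_mul _ hb, vecMul_one]
  rw [h1, vecMul_eq_sum]
  exact sum_mem fun l _ => Submodule.smul_mem _ _ (Submodule.subset_span ⟨b l, rfl⟩)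

end Frame

/-! ### Rings between the curve and its function field -/

section NotRegular

open PowerSeries

/-- A local ring of power series that contains the multiples of `x ^ c`, but no power series of
order one, is not regular: it has dimension at most one, so that its maximal ideal would be principal
and the orders of its elements the multiples of a number `q ≥ 2`. -/
theorem not_isRegularLocalRing {k L : Type*} [Field k] [CommRing L] (hL : IsRegularLocalRing L)
    (φ : L →+* k⟦X⟧) (hinj : Function.Injective φ) (hloc : ∀ l, IsUnit (φ l) → IsUnit l)
    {c : ℕ} (hc : 0 < c) {κ : k⟦X⟧ → L} (hκ : ∀ f, φ (κ f) = X ^ c * f)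
    (h1 : ∀ l, coeff 1 (φ l) = 0) : False := by
  have : IsDomain L := hinj.isDomain φ
  have hmem (l : L) : l ∈ IsLocalRing.maximalIdeal L ↔ X ∣ φ l := by
    rw [IsLocalRing.mem_maximalIdeal, mem_nonunits_iff, X_dvd_iff, ← not_iff_not, not_not,
      ← ne_eq, ← isUnit_iff_ne_zero, ← isUnit_iff_constantCoeff]
    exact ⟨fun h => h.map φ, hloc l⟩
  -- Some power of every `a` in the maximal ideal is a multiple of a given `f ≠ 0`, as the quotient is
  -- a power series divisible by `x ^ c`.
  have hdim : Ring.KrullDimLE 1 L := by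
    refine .mk₁' fun Q hQ hQp => ?_
    obtain ⟨f, hf, hf0⟩ := Submodule.exists_mem_ne_zero_of_ne_bot hQ
    have : Q = IsLocalRing.maximalIdeal L := by
      refine le_antisymm (IsLocalRing.le_maximalIdeal hQp.ne_top) fun a ha => ?_
      obtain ⟨N, hN⟩ := IsDiscreteValuationRing.associated_pow_irreducible
        ((map_ne_zero_iff φ hinj).2 hf0) (X_irreducible (R := k))
      obtain ⟨b, hb⟩ := (hmem a).1 ha
      obtain ⟨w, hw⟩ := hN.dvd
      have h2 : a ^ (N + c) = f * κ (w * b ^ (N + c)) := hinj (by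
        rw [map_pow, hb, map_mul, hκ, mul_pow, pow_add X, hw]
        ring)
      exact hQp.mem_of_pow_mem (N + c) (h2 ▸ Ideal.mul_mem_right _ _ hf)
    rw [this]
    infer_instance
  obtain ⟨t, ht⟩ : ∃ t, IsLocalRing.maximalIdeal L = Ideal.span {t} := by
    have h2 : (IsLocalRing.maximalIdeal L).spanFinrank ≤ 1 := by
      have h3 := hL.spanFinrank_maximalIdeal
      have h4 := (Ring.krullDimLE_iff (R := L) (n := 1)).1 hdim
      rw [← h3] at h4
      exact_mod_cast h4
    have h3 := Submodule.FG.generators_ncard (IsLocalRing.maximalIdeal L).fg_of_isNoetherianRing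
    rw [← h3, Set.ncard_le_one_iff_eq (Submodule.FG.finite_generators
      (IsLocalRing.maximalIdeal L).fg_of_isNoetherianRing)] at h2
    have h4 := Submodule.span_generators (IsLocalRing.maximalIdeal L)
    rcases h2 with h2 | ⟨t, h2⟩
    · refine ⟨0, ?_⟩
      rw [← h4, h2]
      simp
    · exact ⟨t, by rw [← h4, h2]⟩
  have hκmem (f : k⟦X⟧) : κ f ∈ IsLocalRing.maximalIdeal L := by
    rw [hmem, hκ]
    exact (dvd_pow_self X hc.ne').mul_right f
  have ht0 : φ t ≠ 0 := by
    intro h0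
    obtain ⟨b, hb⟩ := Ideal.mem_span_singleton.1 (ht ▸ hκmem 1)
    have := hκ 1
    rw [hb, map_mul, h0, zero_mul, mul_one] at this
    exact pow_ne_zero c X_ne_zero this.symm
  obtain ⟨q, hq⟩ : ∃ q : ℕ, (φ t).order = q := ⟨_, (coe_toNat_order ht0).symm⟩
  have hq2 : q ≠ 1 := by
    rintro rfl
    exact (order_eq_nat.1 hq).1 (h1 t)
  -- Divide by the generator `t` of order `q` as long as the order is positive.
  have key (N : ℕ) : ∀ l, (φ l).order = N → q ∣ N := by
    induction N using Nat.strong_induction_on with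
    | _ N ih =>
      intro l hl
      rcases Nat.eq_zero_or_pos N with rfl | hN
      · exact dvd_zero q
      have hlm : l ∈ IsLocalRing.maximalIdeal L := by
        rw [hmem, X_dvd_iff, ← coeff_zero_eq_constantCoeff_apply]
        exact coeff_of_lt_order _ (by rw [hl]; exact_mod_cast hN)
      obtain ⟨l', rfl⟩ := Ideal.mem_span_singleton.1 (ht ▸ hlm)
      rw [map_mul, order_mul, hq] at hl
      have hl' : φ l' ≠ 0 := by
        intro h0
        rw [h0, order_zero] at hl
        simp at hl
      rw [← coe_toNat_order hl'] at hl
      have h3 : q + (φ l').order.toNat = N := by exact_mod_cast hl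
      have hq0 : 0 < q := by
        rw [Nat.pos_iff_ne_zero]
        rintro rfl
        have h4 : X ∣ φ t := (hmem t).1 (ht ▸ Ideal.mem_span_singleton_self t)
        rw [X_dvd_iff, ← coeff_zero_eq_constantCoeff_apply] at h4
        exact (order_eq_nat.1 hq).1 h4
      have h4 := ih _ (by omega) l' (coe_toNat_order hl').symm
      rw [← h3]
      exact dvd_add dvd_rfl h4
  have h2 := key c (κ 1) (by rw [hκ, mul_one, order_X_pow])
  have h3 := key (c + 1) (κ X) (by rw [hκ, ← pow_succ, order_X_pow])
  exact hq2 (Nat.dvd_one.1 ((Nat.dvd_add_right h2).1 h3))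

end NotRegular

section Intermediate

open PowerSeries

variable {k A : Type u} [Field k] [CommRing A] [Algebra A k⸨X⸩] {S : Subalgebra A k⸨X⸩}

theorem algebraMap_powerSeries_injective (k : Type u) [Field k] :
    Function.Injective (algebraMap k⟦X⟧ k⸨X⸩) := IsFractionRing.injective _ _

theorem hasRegularLocalizations_of_isDedekindDomain (B : Type u) [CommRing B] [IsDedekindDomain B] :
    HasRegularLocalizations B := fun _ _ => inferInstance

/-- A ring of Laurent series without poles, as a ring of power series. -/
def toPowerSeries (h : ∀ s ∈ S, s ∈ (algebraMap k⟦X⟧ k⸨X⸩).range) : S →+* k⟦X⟧ where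
  toFun s := (h s s.2).choose
  map_one' := algebraMap_powerSeries_injective k (by
    rw [(h _ (1 : S).2).choose_spec, map_one]; rfl)
  map_zero' := algebraMap_powerSeries_injective k (by
    rw [(h _ (0 : S).2).choose_spec, map_zero]; rfl)
  map_mul' s t := algebraMap_powerSeries_injective k (by
    rw [(h _ (s * t).2).choose_spec, map_mul, (h _ s.2).choose_spec, (h _ t.2).choose_spec]; rfl)
  map_add' s t := algebraMap_powerSeries_injective k (by
    rw [(h _ (s + t).2).choose_spec, map_add, (h _ s.2).choose_spec, (h _ t.2).choose_spec]; rfl)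

theorem algebraMap_toPowerSeries (h : ∀ s ∈ S, s ∈ (algebraMap k⟦X⟧ k⸨X⸩).range) (s : S) :
    algebraMap k⟦X⟧ k⸨X⸩ (toPowerSeries h s) = s := (h s s.2).choose_spec

theorem toPowerSeries_injective (h : ∀ s ∈ S, s ∈ (algebraMap k⟦X⟧ k⸨X⸩).range) :
    Function.Injective (toPowerSeries h) := fun s t hst => Subtype.ext (by
  rw [← algebraMap_toPowerSeries h, hst, algebraMap_toPowerSeries])

theorem hasRegularLocalizations_of_eq_range
    (h : ∀ s, s ∈ S ↔ s ∈ (algebraMap k⟦X⟧ k⸨X⸩).range) : HasRegularLocalizations S := by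
  refine .of_ringEquiv (RingEquiv.ofBijective (toPowerSeries fun s => (h s).1)
    ⟨toPowerSeries_injective _, fun f => ⟨⟨_, (h _).2 ⟨f, rfl⟩⟩, ?_⟩⟩).symm
    (hasRegularLocalizations_of_isDedekindDomain k⟦X⟧)
  exact algebraMap_powerSeries_injective k (algebraMap_toPowerSeries _ _)

theorem hasRegularLocalizations_of_eq_top (h : S = ⊤) : HasRegularLocalizations S := by
  subst h
  exact .of_ringEquiv Subalgebra.topEquiv.symm.toRingEquiv
    (hasRegularLocalizations_of_isDedekindDomain k⸨X⸩)

namespace Conductor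

variable [Algebra k A] {i : A →ₐ[k] k⟦X⟧} {m : Ideal A}

theorem algebraMap_mem_of_dvd (D : Conductor i m)
    (hA : ∀ a, algebraMap A k⸨X⸩ a = algebraMap k⟦X⟧ k⸨X⸩ (i a))
    {f : k⟦X⟧} (hf : X ^ D.c ∣ f) : algebraMap k⟦X⟧ k⸨X⸩ f ∈ S := by
  obtain ⟨g, rfl⟩ := hf
  rw [← D.map_κ, ← hA]
  exact S.algebraMap_mem _

/-- A ring that contains `A` and a power series of order one contains all power series. -/
theorem algebraMap_mem_of_order_one (D : Conductor i m)
    (hA : ∀ a, algebraMap A k⸨X⸩ a = algebraMap k⟦X⟧ k⸨X⸩ (i a))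
    {u : k⟦X⟧} (hu : IsUnit u)
    (ht : algebraMap k⟦X⟧ k⸨X⸩ (X * u) ∈ S) (f : k⟦X⟧) : algebraMap k⟦X⟧ k⸨X⸩ f ∈ S := by
  -- Subtracting a multiple of a power of the series of order one raises the order, and the series
  -- divisible by `x ^ c` lie in `A`.
  have key (N : ℕ) : ∀ f : k⟦X⟧, X ^ (D.c - N) ∣ f → algebraMap k⟦X⟧ k⸨X⸩ f ∈ S := by
    induction N with
    | zero => exact fun f hf => D.algebraMap_mem_of_dvd hA hf
    | succ N ih =>
      intro f hf
      by_cases hN : D.c ≤ N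
      · exact ih f (by rw [Nat.sub_eq_zero_of_le hN, pow_zero]; exact one_dvd f)
      obtain ⟨g, rfl⟩ := hf
      set L := D.c - (N + 1) with hL
      have hu0 : constantCoeff u ≠ 0 := (isUnit_iff_constantCoeff.1 hu).ne_zero
      set r := constantCoeff g / constantCoeff u ^ L with hr
      have h1 : X ^ (D.c - N) ∣ X ^ L * g - C r * (X * u) ^ L := by
        have h2 : X ∣ g - C r * u ^ L := by
          rw [X_dvd_iff, map_sub, map_mul, constantCoeff_C, map_pow, hr,
            div_mul_cancel₀ _ (pow_ne_zero _ hu0), sub_self]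
        rw [show D.c - N = L + 1 by omega, pow_succ, mul_pow,
          show X ^ L * g - C r * (X ^ L * u ^ L) = X ^ L * (g - C r * u ^ L) by ring]
        exact mul_dvd_mul_left _ h2
      have h3 : algebraMap k⟦X⟧ k⸨X⸩ (C r) ∈ S := by
        have : C r = i (algebraMap k A r) := by rw [AlgHom.commutes]; rfl
        rw [this, ← hA]
        exact S.algebraMap_mem _
      have h4 := S.add_mem (ih _ h1) (S.mul_mem h3 (S.pow_mem ht L))
      rwa [← map_pow, ← map_mul, ← map_add, sub_add_cancel] at h4
  exact key D.c f (by rw [Nat.sub_self, pow_zero]; exact one_dvd f)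

/-- A ring that contains `A` and a Laurent series with a pole is the whole field. -/
theorem eq_top_of_notMem_range (D : Conductor i m)
    (hA : ∀ a, algebraMap A k⸨X⸩ a = algebraMap k⟦X⟧ k⸨X⸩ (i a))
    {y : k⸨X⸩} (hy : y ∈ S)
    (hy' : y ∉ (algebraMap k⟦X⟧ k⸨X⸩).range) : S = ⊤ := by
  rw [eq_top_iff]
  intro z _
  have hy0 : y ≠ 0 := by
    rintro rfl
    exact hy' (zero_mem _)
  obtain ⟨h, hh⟩ : ∃ h : k⟦X⟧, algebraMap k⟦X⟧ k⸨X⸩ h = y⁻¹ := by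
    rcases ValuationRing.isInteger_or_isInteger k⟦X⟧ y with h | h
    · exact absurd h hy'
    · exact h
  have hX : X ∣ h := by
    by_contra hX
    have hu : IsUnit h := by
      rw [X_dvd_iff] at hX
      exact isUnit_iff_constantCoeff.2 (isUnit_iff_ne_zero.2 hX)
    obtain ⟨v, hv⟩ := hu.exists_right_inv
    refine hy' ⟨v, ?_⟩
    have := congrArg (algebraMap k⟦X⟧ k⸨X⸩) hv
    rw [map_mul, hh, map_one] at this
    rw [← mul_one y, ← this, mul_inv_cancel_left₀ hy0]
  obtain ⟨h', rfl⟩ := hX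
  obtain ⟨f, g, hg, rfl⟩ := IsFractionRing.div_surjective (A := k⟦X⟧) z
  have hg0 : algebraMap k⟦X⟧ k⸨X⸩ g ≠ 0 :=
    (map_ne_zero_iff _ (algebraMap_powerSeries_injective k)).2 (nonZeroDivisors.ne_zero hg)
  obtain ⟨N, hN⟩ := IsDiscreteValuationRing.associated_pow_irreducible
    (nonZeroDivisors.ne_zero hg) (X_irreducible (R := k))
  obtain ⟨w, hw⟩ := hN.dvd
  have h1 : algebraMap k⟦X⟧ k⸨X⸩ f / algebraMap k⟦X⟧ k⸨X⸩ g = y ^ (N + D.c) *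
      algebraMap k⟦X⟧ k⸨X⸩ (X ^ D.c * (w * h' ^ (N + D.c) * f)) := by
    rw [div_eq_iff hg0, mul_assoc, ← map_mul,
      show X ^ D.c * (w * h' ^ (N + D.c) * f) * g = (X * h') ^ (N + D.c) * f by
        rw [mul_pow, pow_add X, hw]; ring,
      map_mul, map_pow, hh, inv_pow, mul_inv_cancel_left₀ (pow_ne_zero _ hy0)]
  rw [h1]
  exact S.mul_mem (S.pow_mem hy _) (D.algebraMap_mem_of_dvd hA (Dvd.intro _ rfl))

/-- A ring of power series that contains `A` but no power series of order one is not regular. -/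
theorem not_hasRegularLocalizations (D : Conductor i m)
    (hA : ∀ a, algebraMap A k⸨X⸩ a = algebraMap k⟦X⟧ k⸨X⸩ (i a))
    (h : ∀ s ∈ S, ∃ f : k⟦X⟧, coeff 1 f = 0 ∧ algebraMap k⟦X⟧ k⸨X⸩ f = s) :
    ¬ HasRegularLocalizations S := by
  intro hreg
  have hS : ∀ s ∈ S, s ∈ (algebraMap k⟦X⟧ k⸨X⸩).range := fun s hs => by
    obtain ⟨f, -, hf⟩ := h s hs
    exact ⟨f, hf⟩
  let θ := toPowerSeries hS
  have hθ1 (s : S) : coeff 1 (θ s) = 0 := by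
    obtain ⟨f, hf, hfs⟩ := h s s.2
    have : θ s = f := algebraMap_powerSeries_injective k (by
      rw [hfs]; exact algebraMap_toPowerSeries hS s)
    rw [this, hf]
  let P : Ideal S := (IsLocalRing.maximalIdeal k⟦X⟧).comap θ
  have hP (s : S) : s ∈ P.primeCompl ↔ IsUnit (θ s) := by
    rw [Ideal.mem_primeCompl_iff, Ideal.mem_comap, IsLocalRing.mem_maximalIdeal, mem_nonunits_iff,
      not_not]
  have hunit (s : P.primeCompl) : IsUnit (θ s) := (hP s).1 s.2
  let φ : Localization.AtPrime P →+* k⟦X⟧ := IsLocalization.lift hunit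
  refine not_isRegularLocalRing (hreg P) φ ?_ ?_ D.pos
    (κ := fun f => algebraMap S (Localization.AtPrime P) (algebraMap A S (D.κ f))) ?_ ?_
  · rw [IsLocalization.lift_injective_iff]
    intro s t
    rw [(IsLocalization.injective (Localization.AtPrime P)
      P.primeCompl_le_nonZeroDivisors).eq_iff, (toPowerSeries_injective hS).eq_iff]
  · intro l hl
    obtain ⟨a, s, rfl⟩ := IsLocalization.exists_mk'_eq P.primeCompl l
    rw [IsLocalization.AtPrime.isUnit_mk'_iff _ P, hP]
    have h1 : θ a = θ s * φ (IsLocalization.mk' _ a s) :=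
      (IsLocalization.lift_mk'_spec (g := θ) hunit a _ s).1 rfl
    rw [h1]
    exact (hunit s).mul hl
  · intro f
    rw [IsLocalization.lift_eq, ← D.map_κ]
    refine algebraMap_powerSeries_injective k ?_
    rw [algebraMap_toPowerSeries, ← hA]
    rfl
  · intro l
    obtain ⟨a, s, rfl⟩ := IsLocalization.exists_mk'_eq P.primeCompl l
    have h1 : θ a = θ s * φ (IsLocalization.mk' _ a s) :=
      (IsLocalization.lift_mk'_spec (g := θ) hunit a _ s).1 rfl
    have h2 := congrArg (coeff 1) h1
    rw [hθ1, coeff_mul, Finset.Nat.sum_antidiagonal_eq_sum_range_succ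
      fun p q => coeff p (θ s) * coeff q _, Finset.sum_range_succ, Finset.sum_range_one, hθ1,
      zero_mul, add_zero, coeff_zero_eq_constantCoeff_apply] at h2
    exact (mul_eq_zero.1 h2.symm).resolve_left (isUnit_iff_constantCoeff.1 (hunit s)).ne_zero

end Conductor

end Intermediate

/-! ### The coordinate rings of the charts -/

section Charts

variable {R : Type u} [CommRing R] {M : Type u} [AddCommGroup M] [Module R M] {r : ℕ}
  {K : Type u} [Field K] [Algebra R K] {Φ : M →ₗ[R] (Fin r → K)} {b : Fin r → M}
  (hb : IsUnit (frameMatrix Φ b).det)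

theorem frameCoord_mem_range (x : M) (l : Fin r) :
    frameCoord Φ b x l ∈ (chartToField Φ b hb).range :=
  ⟨coord b x l, chartLift_coord b _ _ x l⟩

theorem mem_of_mem_range_chartToField {T : Subring K} (hR : ∀ a : R, algebraMap R K a ∈ T)
    (hT : ∀ x l, frameCoord Φ b x l ∈ T) {s : K} (hs : s ∈ (chartToField Φ b hb).range) : s ∈ T := by
  obtain ⟨y, rfl⟩ := hs
  induction y using ChartRing.induction with
  | algebraMap a => exact (AlgHom.commutes (chartToField Φ b hb) a).symm ▸ hR a
  | coord x l => exact (chartLift_coord b _ (frameCoord_self hb) x l).symm ▸ hT x l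
  | mul x y hx hy => exact (map_mul (chartToField Φ b hb) x y).symm ▸ T.mul_mem hx hy
  | add x y hx hy => exact (map_add (chartToField Φ b hb) x y).symm ▸ T.add_mem hx hy

/-- The change of coordinates between two frames. -/
theorem frameCoord_eq_vecMul {b' : Fin r → M} (hb' : IsUnit (frameMatrix Φ b').det) (x : M) :
    frameCoord Φ b x =
      Matrix.vecMul (frameCoord Φ b' x) (Matrix.of fun l => frameCoord Φ b (b' l)) := by
  have h1 : (Matrix.of fun l => frameCoord Φ b (b' l)) =
      frameMatrix Φ b' * (frameMatrix Φ b)⁻¹ := by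
    ext l j
    rfl
  rw [h1, frameCoord_apply, frameCoord_apply, Matrix.vecMul_vecMul, ← Matrix.mul_assoc,
    Matrix.nonsing_inv_mul _ hb', Matrix.one_mul]

end Charts

/-! ### Regularity and the monoid of orders -/

section Main

open PowerSeries Matrix

variable {k A : Type u} [Field k] [CommRing A] [Algebra k A] {i : A →ₐ[k] k⟦X⟧}
  {m : Ideal A}

theorem coeff_one_eq_zero_of_notMem_orders {s : ℕ} (hs : s ∉ orders i) (a : A) :
    coeff 1 (i a) = 0 := by
  by_contra h1
  set a' := a - algebraMap k A (constantCoeff (i a)) with ha'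
  have h2 : i a' = i a - C (constantCoeff (i a)) := by
    rw [ha', map_sub, AlgHom.commutes]; rfl
  have h3 : order (i a') = (1 : ℕ) := by
    rw [order_eq_nat, h2]
    refine ⟨?_, fun d hd => ?_⟩
    · rwa [map_sub, coeff_C, if_neg one_ne_zero, sub_zero]
    · obtain rfl : d = 0 := by omega
      simp
  refine hs ⟨a' ^ s, ?_⟩
  rw [map_pow, order_pow, h3]
  simp

namespace Conductor

variable [CharZero k] [Algebra A k⸨X⸩]

/-- If the gap below `orderNth i (n + 1)` is larger than one, then the chart of the adapted frame
is not regular, as its coordinate ring contains no power series of order one. -/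
theorem not_hasRegularLocalizations_adaptedFrame (D : Conductor i m)
    (hA : ∀ a, algebraMap A k⸨X⸩ a = algebraMap k⟦X⟧ k⸨X⸩ (i a)) {n : ℕ}
    (h : orderNth i (n + 1) - 1 ∉ orders i) :
    ¬ HasRegularLocalizations (chartToField (principalJet D.dvd_of_mem hA n) (D.adaptedFrame n)
      (D.isUnit_det_adaptedFrame hA n)).range := by
  let T : Subring k⟦X⟧ :=
    { carrier := {f | coeff 1 f = 0}
      mul_mem' := fun {f g} (hf : coeff 1 f = 0) (hg : coeff 1 g = 0) => by
        change coeff 1 (f * g) = 0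
        rw [coeff_mul, Finset.Nat.sum_antidiagonal_eq_sum_range_succ
          fun p q => coeff p f * coeff q g]
        simp [Finset.sum_range_succ, hf, hg]
      one_mem' := by simp [coeff_one]
      add_mem' := fun {f g} (hf : coeff 1 f = 0) (hg : coeff 1 g = 0) => by
        change coeff 1 (f + g) = 0
        rw [map_add, hf, hg, add_zero]
      zero_mem' := by simp
      neg_mem' := fun {f} (hf : coeff 1 f = 0) => by
        change coeff 1 (-f) = 0
        rw [map_neg, hf, neg_zero] }
  have hT (a : A) : i a ∈ T := coeff_one_eq_zero_of_notMem_orders h a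
  have hgap : orderNth i n + 2 ≤ orderNth i (n + 1) := by
    have h1 := D.orderNth_strictMono (Nat.lt_succ_self n)
    have h2 : orderNth i n ≠ orderNth i (n + 1) - 1 := fun h2 =>
      h (h2 ▸ Nat.nth_mem_of_infinite D.infinite_orders n)
    change orderNth i n < orderNth i (n + 1) at h1
    omega
  have hX (l : Fin (n + 1)) (f : k⟦X⟧) : X ^ (orderNth i (n + 1) - orderNth i l) * f ∈ T := by
    have h1 : orderNth i l ≤ orderNth i n := D.orderNth_strictMono.monotone (by omega)
    exact X_pow_dvd_iff.1 (Dvd.intro f rfl) 1 (by omega)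
  refine D.not_hasRegularLocalizations hA fun s hs => ?_
  obtain ⟨f, hf, rfl⟩ := Subring.mem_map.1 (mem_of_mem_range_chartToField
    (T := T.map (algebraMap k⟦X⟧ k⸨X⸩)) (D.isUnit_det_adaptedFrame hA n)
    (fun a => by rw [hA]; exact Subring.mem_map.2 ⟨_, hT a, rfl⟩) (D.frameCoord_mem hA n hT hX) hs)
  exact ⟨f, hf, rfl⟩

/-- If `orderNth i n` and `orderNth i (n + 1)` are successive numbers, then the coordinate ring of
every chart contains a power series of order one or a series with a pole. -/
theorem hasRegularLocalizations_chart (D : Conductor i m)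
    (hA : ∀ a, algebraMap A k⸨X⸩ a = algebraMap k⟦X⟧ k⸨X⸩ (i a)) {n : ℕ}
    (h : orderNth i (n + 1) = orderNth i n + 1) (b : Fin (n + 1) → PrincipalParts k m n)
    (hb : IsUnit (frameMatrix (principalJet D.dvd_of_mem hA n) b).det) :
    HasRegularLocalizations (chartToField (principalJet D.dvd_of_mem hA n) b hb).range := by
  set Φ := principalJet D.dvd_of_mem hA n
  by_cases hS : ∀ s ∈ (chartToField Φ b hb).range, s ∈ (algebraMap k⟦X⟧ k⸨X⸩).range
  swap
  · push Not at hS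
    obtain ⟨s, hs, hs'⟩ := hS
    exact hasRegularLocalizations_of_eq_top (D.eq_top_of_notMem_range hA hs hs')
  suffices h1 : ∃ u : k⟦X⟧, IsUnit u ∧
      algebraMap k⟦X⟧ k⸨X⸩ (X * u) ∈ (chartToField Φ b hb).range by
    obtain ⟨u, hu, ht⟩ := h1
    refine hasRegularLocalizations_of_eq_range fun s => ⟨hS s, ?_⟩
    rintro ⟨f, rfl⟩
    exact D.algebraMap_mem_of_order_one hA hu ht f
  have hb0 := D.isUnit_det_adaptedFrame hA n
  -- The matrices of the change of coordinates have entries without poles.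
  have hN (l j : Fin (n + 1)) : ∃ f, algebraMap k⟦X⟧ k⸨X⸩ f =
      frameCoord Φ b (D.adaptedFrame n l) j := hS _ (frameCoord_mem_range hb _ j)
  have hN' (l j : Fin (n + 1)) : ∃ f, algebraMap k⟦X⟧ k⸨X⸩ f =
      frameCoord Φ (D.adaptedFrame n) (b l) j := by
    obtain ⟨f, -, hf⟩ := Subring.mem_map.1 (D.frameCoord_mem hA n (T := ⊤) (fun _ => trivial)
      (fun _ _ => trivial) (b l) j)
    exact ⟨f, hf⟩
  choose N hN using hN
  choose N' hN' using hN'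
  set x := differential k m n (D.adapted (n + 1))
  obtain ⟨y, hy, hlast⟩ : ∃ y : Fin (n + 1) → k⟦X⟧, (∀ l, frameCoord Φ (D.adaptedFrame n) x l =
      algebraMap k⟦X⟧ k⸨X⸩ (X * y l)) ∧ IsUnit (y (Fin.last n)) := by
    refine ⟨fun l => X ^ (orderNth i n - orderNth i l) *
      vecMul (fun j : Fin (n + 1) => lead (orderNth i (n + 1)) (i (D.adapted (n + 1))) j)
        (D.adaptedMatrix n)⁻¹ l, fun l => ?_, ?_⟩
    · have h1 : orderNth i l ≤ orderNth i n := D.orderNth_strictMono.monotone (by omega)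
      rw [D.frameCoord_differential hA n (D.dvd_adapted (n + 1)), ← mul_assoc, ← pow_succ',
        ← Nat.sub_add_comm h1, ← h]
    · have := D.isUnit_vecMul_last n
      simpa using this
  have h1 (l : Fin (n + 1)) : frameCoord Φ b x l =
      algebraMap k⟦X⟧ k⸨X⸩ (X * ∑ l', y l' * N l' l) := by
    rw [frameCoord_eq_vecMul hb0, vecMul, dotProduct, Finset.mul_sum, map_sum]
    refine Finset.sum_congr rfl fun l' _ => ?_
    rw [of_apply, hy, ← hN, ← map_mul, mul_assoc]
  have h2 : y (Fin.last n) = ∑ l, (∑ l', y l' * N l' l) * N' l (Fin.last n) := by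
    refine mul_left_cancel₀ (X_ne_zero (R := k)) (algebraMap_powerSeries_injective k ?_)
    rw [← hy, frameCoord_eq_vecMul hb, vecMul, dotProduct, Finset.mul_sum, map_sum]
    refine Finset.sum_congr rfl fun l' _ => ?_
    rw [of_apply, h1, ← hN', ← map_mul, mul_assoc]
  obtain ⟨l, hl⟩ : ∃ l, IsUnit (∑ l', y l' * N l' l) := by
    by_contra! h3
    have h4 : X ∣ y (Fin.last n) := by
      rw [h2]
      refine Finset.dvd_sum fun l _ => Dvd.dvd.mul_right ?_ _
      have := h3 l
      rwa [isUnit_iff_constantCoeff, isUnit_iff_ne_zero, not_not, ← X_dvd_iff] at this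
    rw [X_dvd_iff] at h4
    exact (isUnit_iff_constantCoeff.1 hlast).ne_zero h4
  exact ⟨_, hl, h1 l ▸ frameCoord_mem_range hb x l⟩

theorem isRegularScheme_nash_principalParts_iff [IsDomain A] [IsFractionRing A k⸨X⸩]
    (D : Conductor i m) (hA : ∀ a, algebraMap A k⸨X⸩ a = algebraMap k⟦X⟧ k⸨X⸩ (i a)) (n : ℕ) :
    IsRegularScheme (nash A (PrincipalParts k m n) (n + 1)) ↔
      orderNth i (n + 1) - 1 ∈ orders i := by
  rw [isRegularScheme_nash_iff (Nat.succ_pos n)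
    (span_range_eq_top_of_isUnit_det (D.isUnit_det_adaptedFrame hA n))
    (exists_smul_eq_zero_of_principalJet_eq_zero hA n D)]
  refine ⟨fun h => ?_, fun h b hb => D.hasRegularLocalizations_chart hA ?_ b hb⟩
  · by_contra h1
    exact D.not_hasRegularLocalizations_adaptedFrame hA h1 (h _ _)
  · have h1 : orderNth i n < orderNth i (n + 1) := D.orderNth_strictMono (Nat.lt_succ_self n)
    have h2 : orderNth i (n + 1) - 1 ≤ orderNth i n :=
      Nat.le_nth_of_lt_nth_succ (show orderNth i (n + 1) - 1 < orderNth i (n + 1) by omega) h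
    omega

end Conductor

/-- A finite birational extension `R ⊆ k⟦x⟧` has a conductor. -/
theorem nonempty_conductor {k : Type u} [Field k] (R : Subalgebra k k⟦X⟧)
    (hfin : Module.Finite R k⟦X⟧) (hfrac : IsFractionRing R k⸨X⸩) :
    Nonempty (Conductor R.val (maxIdeal R)) := by
  obtain ⟨s, hs⟩ := hfin.fg_top
  classical
  obtain ⟨d, hd⟩ := IsLocalization.exist_integer_multiples_of_finset (nonZeroDivisors R)
    (s.image (algebraMap k⟦X⟧ k⸨X⸩))
  have hd0 : (d : R).1 ≠ 0 := fun h => nonZeroDivisors.ne_zero d.2 (Subtype.ext h)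
  have h1 (f : k⟦X⟧) : (d : R).1 * f ∈ R := by
    have hf : f ∈ Submodule.span R (s : Set k⟦X⟧) := hs ▸ Submodule.mem_top
    induction hf using Submodule.span_induction with
    | mem f hf =>
      obtain ⟨r, hr⟩ := hd _ (Finset.mem_image_of_mem _ hf)
      have : r.1 = (d : R).1 * f := algebraMap_powerSeries_injective k (by
        rw [map_mul]
        refine Eq.trans hr ?_
        rw [Submonoid.smul_def, Algebra.smul_def])
      exact this ▸ r.2
    | zero => rw [mul_zero]; exact R.zero_mem
    | add f g _ _ hf hg => rw [mul_add]; exact R.add_mem hf hg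
    | smul r f _ hf =>
      have : (d : R).1 * r • f = r.1 * ((d : R).1 * f) := mul_left_comm _ _ _
      rw [this]
      exact R.mul_mem r.2 hf
  obtain ⟨c, hc⟩ := IsDiscreteValuationRing.associated_pow_irreducible hd0 (X_irreducible (R := k))
  obtain ⟨w, hw⟩ := hc.dvd
  have h2 (f : k⟦X⟧) : X ^ (c + 1) * f ∈ R := by
    rw [pow_succ, hw, mul_assoc, mul_assoc]
    exact h1 _
  exact ⟨{
    c := c + 1
    κ :=
      { toFun := fun f => ⟨X ^ (c + 1) * f, h2 f⟩
        map_add' := fun f g => Subtype.ext (mul_add _ _ _)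
        map_smul' := fun r f => Subtype.ext (mul_smul_comm _ _ _) }
    pos := Nat.succ_pos c
    map_κ := fun f => rfl
    injective := Subtype.val_injective
    mem_iff := fun f => by
      rw [maxIdeal, Ideal.mem_comap, IsLocalRing.mem_maximalIdeal, mem_nonunits_iff,
        isUnit_iff_constantCoeff, isUnit_iff_ne_zero, not_not, ← X_dvd_iff]
      rfl }⟩

end Main

end NashBlowup
end

theorem theorem3p2 (k : Type u) [Field k] [IsAlgClosed k] [CharZero k]
    (R : Subalgebra k k⟦X⟧) (hfin : Module.Finite R k⟦X⟧) (hfrac : IsFractionRing R k⸨X⸩)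
    (hcomplete : IsAdicComplete (NashBlowup.maxIdeal R) R) (n : ℕ) :
    NashBlowup.IsRegularScheme (NashBlowup.higherNash k (NashBlowup.maxIdeal R) 1 n) ↔
      NashBlowup.orderSeq R n - 1 ∈ NashBlowup.orderMonoid R := by
  obtain ⟨D⟩ := NashBlowup.nonempty_conductor R hfin hfrac
  have h1 := D.isRegularScheme_nash_principalParts_iff (fun _ => rfl) n
  have h2 (s : ℕ) : s ∈ NashBlowup.orders R.val ↔ s ∈ NashBlowup.orderMonoid R :=
    ⟨fun ⟨f, hf⟩ => ⟨f, f.2, hf⟩, fun ⟨f, hf, hs⟩ => ⟨⟨f, hf⟩, hs⟩⟩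
  rw [NashBlowup.higherNash, Nat.choose_one_right, h1, h2, NashBlowup.orderSeq,
    NashBlowup.orderNth]
  simp only [h2]
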